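/- Let $\Bbbk$ be a field of characteristic $0$ and $g$ a natural number. A point of size $s$ is a tuple $Y=(Y_1,\dots,Y_g)\in M_s(\Bbbk)^g$; for $S\in M_s(\Bbbk)$ and $Z\in M_s(\Bbbk)^g$ write $SZ=(SZ_j)_j$, $ZS=(Z_jS)_j$, $[S,Y]=(SY_j-Y_jS)_j$, and let $\mathcal C(Y)=\{S: [S,Y]=0\}$. A point is irreducible if its matrices have no nontrivial common invariant subspace (and $s\ge1$), and semisimple if it is similar (under simultaneous conjugation by an invertible matrix) to a direct sum of irreducible points, its irreducible blocks. Semisimple points $Y^1,\dots,Y^h$ are separated if for $i\ne j$ no irreducible block of $Y^i$ is similar to an irreducible block of $Y^j$. A sequence $(f_\ell)_{\ell=0}^L$ of $\ell$-linear maps $f_\ell:(M_s(\Bbbk)^g)^\ell\to M_s(\Bbbk)$ satisfies $\mathrm{LAC}_L(Y)$ if $f_1([S,Y])=[S,f_0]$ (when $L\ge1$) and, for $2\le\ell\le L$, $1\le j\le \ell-2$, all $S\in M_s(\Bbbk)$ and all $Z^1,\dots,Z^{\ell-1}\in M_s(\Bbbk)^g$, \begin{align*} f_\ell([S,Y],Z^1,\dots,Z^{\ell-1})&=Sf_{\ell-1}(Z^1,\dots,Z^{\ell-1})-f_{\ell-1}(SZ^1,Z^2,\dots,Z^{\ell-1}),\\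 f_\ell(\dots,Z^j,[S,Y],Z^{j+1},\dots)&=f_{\ell-1}(\dots,Z^jS,Z^{j+1},\dots)-f_{\ell-1}(\dots,Z^j,SZ^{j+1},\dots),\\ f_\ell(Z^1,\dots,Z^{\ell-1},[S,Y])&=f_{\ell-1}(Z^1,\dots,Z^{\ell-2},Z^{\ell-1}S)-f_{\ell-1}(Z^1,\dots,Z^{\ell-1})S, \end{align*} and moreover for all $S\in\mathcal C(Y)$ and $Z^1,\dots,Z^L\in M_s(\Bbbk)^g$: if $L\ge1$, then $Sf_L(Z^1,\dots,Z^L)=f_L(SZ^1,Z^2,\dots,Z^L)$, $f_L(\dots,Z^jS,Z^{j+1},\dots)=f_L(\dots,Z^j,SZ^{j+1},\dots)$ for $1\le j\le L-1$, and $f_L(Z^1,\dots,Z^{L-1},Z^LS)=f_L(Z^1,\dots,Z^L)S$; if $L=0$, then $[S,f_0]=0$. An nc set is a graded set $\Omega=\bigsqcup_n\Omega_n$ with $\Omega_n\subseteq M_n(\Bbbk)^g$ that is closed under direct sums; it is (right) admissible if for all $X\in\Omega_m$, $X'\in\Omega_n$, $Z\in(\Bbbk^{m\times n})^g$ there is $\alpha\in\Bbbk\setminus\{0\}$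 with $\begin{pmatrix}X&\alpha Z\\0&X'\end{pmatrix}\in\Omega_{m+n}$. An nc function on $\Omega$ is a map $f$ with $f(\Omega_n)\subseteq M_n(\Bbbk)$ that respects direct sums and similarities. If $\Omega$ is admissible and $Y\in\Omega_s$, the $\ell$-th nc differential of $f$ at $Y$ is the $\ell$-linear map $\Delta^\ell_Yf:(M_s(\Bbbk)^g)^\ell\to M_s(\Bbbk)$ such that $\Delta_Y^\ell f(Z^1,\dots,Z^\ell)$ is the upper right $s\times s$ block of $f(X)$ whenever the $(\ell+1)\times(\ell+1)$ block matrix tuple $X$ with diagonal blocks $Y$, superdiagonal blocks $Z^1,\dots,Z^\ell$ and zero blocks elsewhere lies in $\Omega$; $\Delta^0_Yf=f(Y)$. An nc polynomial, i.e. an element of the free algebra $\Bbbk\langle x_1,\dots,x_g\rangle$, is an nc function on all of $\bigsqcup_nM_n(\Bbbk)^g$. Theorem (free Hermite interpolation). (1) Let $Y^i\in M_{s_i}(\Bbbk)^g$, $1\le i\le h$, be separated semisimple points and $L\ge0$. For each $i$ let $(f^{(i)}_\ell)_{\ell=0}^L$ be a sequence of $\ell$-linear maps $f^{(i)}_\ell:(M_{s_i}(\Bbbk)^g)^\ell\to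 M_{s_i}(\Bbbk)$ satisfying $\mathrm{LAC}_L(Y^i)$. Then there is an nc polynomial $p$ such that $\Delta^\ell_{Y^i}p=f^{(i)}_\ell$ for all $1\le i\le h$ and $0\le\ell\le L$. (2) Let $f$ be an nc function on an admissible nc set $\Omega$, let $Y^1,\dots,Y^h\in\Omega$ be semisimple points (not necessarily separated), and $L\ge0$. Then there is an nc polynomial $p$ such that the nc differentials of $f$ and $p$ at these points exist and agree up to order $L$: $\Delta^\ell_{Y^i}p=\Delta^\ell_{Y^i}f$ for all $1\le i\le h$ and $0\le\ell\le L$. -/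

import Mathlib

namespace FreeNC

/-- A point of size `n` of the nc space over `k^g`: a `g`-tuple of `n × n` matrices. -/
abbrev Point (k : Type*) (g n : ℕ) : Type _ := Fin g → Matrix (Fin n) (Fin n) k

section Algebra

variable {k : Type*} [Field k] {g : ℕ}

/-- `S Z = (S Z_1, …, S Z_g)`. -/
def lmul {n : ℕ} (S : Matrix (Fin n) (Fin n) k) (Z : Point k g n) : Point k g n :=
  fun j => S * Z j

/-- `Z S = (Z_1 S, …, Z_g S)`. -/
def rmul {n : ℕ} (Z : Point k g n) (S : Matrix (Fin n) (Fin n) k) : Point k g n :=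
  fun j => Z j * S

/-- `[S, Y] = (S Y_1 - Y_1 S, …, S Y_g - Y_g S)`. -/
def bracket {n : ℕ} (S : Matrix (Fin n) (Fin n) k) (Y : Point k g n) : Point k g n :=
  fun j => S * Y j - Y j * S

/-! ### Irreducible, semisimple and separated points -/

/-- Similarity of tuples of matrices `Y' = P Y P⁻¹` with `P` invertible. The index types of `Y`
and `Y'` are identified through a bijection `e` (any other choice of `e` changes `P` by a
permutation matrix); in particular similar points have the same size. -/
def Similar {ι ι' : Type} [Fintype ι'] [DecidableEq ι']
    (Y : Fin g → Matrix ι ι k) (Y' : Fin g → Matrix ι' ι' k) : Prop :=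
  ∃ (e : ι ≃ ι') (P : (Matrix ι' ι' k)ˣ), ∀ j,
    Y' j = (P : Matrix ι' ι' k) * Matrix.reindex e e (Y j) * ((P⁻¹ : (Matrix ι' ι' k)ˣ) : Matrix ι' ι' k)

/-- A point of positive size without nontrivial common invariant subspaces. -/
def IsIrreduciblePoint {s : ℕ} (Y : Point k g s) : Prop :=
  0 < s ∧ ∀ W : Submodule k (Fin s → k),
    (∀ j, ∀ v ∈ W, (Y j).mulVec v ∈ W) → W = ⊥ ∨ W = ⊤

/-- `Y` is similar to the direct sum `B_1 ⊕ ⋯ ⊕ B_r` and every `B_a` is irreducible; the `B_a` are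
then the irreducible blocks of `Y`. -/
def IsIrredDecomp {s : ℕ} (Y : Point k g s) {r : ℕ} {n : Fin r → ℕ}
    (B : ∀ a, Point k g (n a)) : Prop :=
  (∀ a, IsIrreduciblePoint (B a)) ∧
    Similar (fun j => Matrix.blockDiagonal' fun a => B a j) Y

/-- A point is semisimple if it is similar to a direct sum of irreducible points. -/
def IsSemisimplePoint {s : ℕ} (Y : Point k g s) : Prop :=
  ∃ (r : ℕ) (n : Fin r → ℕ) (B : ∀ a, Point k g (n a)), IsIrredDecomp Y B

/-- For different `i`, `i'`, no irreducible block of `Y i` is similar to one of `Y i'`. -/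
def Separated {h : ℕ} {s : Fin h → ℕ} (Y : ∀ i, Point k g (s i)) : Prop :=
  ∀ i i', i ≠ i' →
    ∀ (r r' : ℕ) (n : Fin r → ℕ) (n' : Fin r' → ℕ)
      (B : ∀ a, Point k g (n a)) (B' : ∀ a, Point k g (n' a)),
      IsIrredDecomp (Y i) B → IsIrredDecomp (Y i') B' → ∀ a a', ¬ Similar (B a) (B' a')

/-! ### Linear compatibility conditions -/

/-- `ℓ`-linear maps `(M_s(k)^g)^ℓ → M_s(k)`. -/
abbrev MultiMap (k : Type*) [Field k] (g s ℓ : ℕ) : Type _ :=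
  MultilinearMap k (fun _ : Fin ℓ => Point k g s) (Matrix (Fin s) (Fin s) k)

/-- Multiplication by `S` from the right of what stands before the gap `t` in
`f (Z^1, …, Z^m)`: this is `S f (Z^1, …, Z^m)` for the gap `0` in front of `Z^1`,
and `f (…, Z^j S, Z^(j+1), …)` for the gap just after `Z^j`. -/
def gapLeft {s m : ℕ} (f : MultiMap k g s m) (t : Fin (m + 1)) (S : Matrix (Fin s) (Fin s) k)
    (Z : Fin m → Point k g s) : Matrix (Fin s) (Fin s) k :=
  Fin.cases (motive := fun _ => Matrix (Fin s) (Fin s) k) (S * f Z)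
    (fun j => f (Function.update Z j (rmul (Z j) S))) t

/-- Multiplication by `S` from the left of what stands after the gap `t` in
`f (Z^1, …, Z^m)`: this is `f (Z^1, …, Z^m) S` for the gap after `Z^m`,
and `f (…, Z^j, S Z^(j+1), …)` for the gap just before `Z^(j+1)`. -/
def gapRight {s m : ℕ} (f : MultiMap k g s m) (t : Fin (m + 1)) (S : Matrix (Fin s) (Fin s) k)
    (Z : Fin m → Point k g s) : Matrix (Fin s) (Fin s) k :=
  Fin.lastCases (motive := fun _ => Matrix (Fin s) (Fin s) k) (f Z * S)
    (fun j => f (Function.update Z j (lmul S (Z j)))) t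

/-- The truncated linear compatibility conditions of order `L` at `Y`; they involve only
`F 0, …, F L`. The first part has `[S, Y]` at position `t` among the arguments of `F (m + 1)`:
for `m = 0` it is `F 1 [S, Y] = [S, F 0]`, and for `m ≥ 1` it consists of the three equations with
`[S, Y]` as the first, a middle, and the last argument. The second part is the invariance of `F L`
under the centralizer of `Y`; for `L = 0` it says that `F 0` commutes with the centralizer. -/
def TruncLAC {s : ℕ} (Y : Point k g s) (L : ℕ) (F : ∀ ℓ : ℕ, MultiMap k g s ℓ) : Prop :=
  (∀ m, m < L → ∀ (t : Fin (m + 1)) (S : Matrix (Fin s) (Fin s) k) (Z : Fin m → Point k g s),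
    F (m + 1) (Fin.insertNth (α := fun _ => Point k g s) t (bracket S Y) Z)
      = gapLeft (F m) t S Z - gapRight (F m) t S Z) ∧
  (∀ (t : Fin (L + 1)) (S : Matrix (Fin s) (Fin s) k), (∀ j, S * Y j = Y j * S) →
    ∀ Z : Fin L → Point k g s, gapLeft (F L) t S Z = gapRight (F L) t S Z)

/-! ### Noncommutative functions and their differentials -/

/-- The block upper triangular point `(X, Z; 0, Y)` of size `m + n`. -/
def upperBlock {m n : ℕ} (X : Point k g m) (Z : Fin g → Matrix (Fin m) (Fin n) k)
    (Y : Point k g n) : Point k g (m + n) :=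
  fun j => Matrix.reindex finSumFinEquiv finSumFinEquiv (Matrix.fromBlocks (X j) (Z j) 0 (Y j))

/-- The direct sum `A ⊕ B` of two square matrices. -/
def directSum {m n : ℕ} (A : Matrix (Fin m) (Fin m) k) (B : Matrix (Fin n) (Fin n) k) :
    Matrix (Fin (m + n)) (Fin (m + n)) k :=
  Matrix.reindex finSumFinEquiv finSumFinEquiv (Matrix.fromBlocks A 0 0 B)

/-- A graded subset of the nc space, closed under direct sums. -/
def IsNCSet (Ω : ∀ n : ℕ, Set (Point k g n)) : Prop :=
  ∀ (m n : ℕ) (X : Point k g m) (Y : Point k g n), X ∈ Ω m → Y ∈ Ω n →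
    (fun j => directSum (X j) (Y j)) ∈ Ω (m + n)

/-- Right admissibility of a graded subset of the nc space. -/
def IsRightAdmissible (Ω : ∀ n : ℕ, Set (Point k g n)) : Prop :=
  ∀ (m n : ℕ) (X : Point k g m) (Y : Point k g n) (Z : Fin g → Matrix (Fin m) (Fin n) k),
    X ∈ Ω m → Y ∈ Ω n → ∃ α : k, α ≠ 0 ∧ upperBlock X (α • Z) Y ∈ Ω (m + n)

/-- `f` is an nc function on `Ω`: graded (by its type), it respects direct sums and similarities.
Only the values of `f` on `Ω` matter. -/
structure IsNCFunction (Ω : ∀ n : ℕ, Set (Point k g n))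
    (f : ∀ n : ℕ, Point k g n → Matrix (Fin n) (Fin n) k) : Prop where
  map_directSum : ∀ (m n : ℕ) (X : Point k g m) (Y : Point k g n), X ∈ Ω m → Y ∈ Ω n →
    f (m + n) (fun j => directSum (X j) (Y j)) = directSum (f m X) (f n Y)
  map_similar : ∀ (n : ℕ) (X : Point k g n) (P : (Matrix (Fin n) (Fin n) k)ˣ), X ∈ Ω n →
    (fun j => P.val * X j * P.inv) ∈ Ω n →
    f n (fun j => P.val * X j * P.inv) = P.val * f n X * P.inv

/-- The nc function given by evaluation of an nc polynomial (an element of the free algebra). -/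
def evalPoly (p : FreeAlgebra k (Fin g)) (n : ℕ) (X : Point k g n) : Matrix (Fin n) (Fin n) k :=
  FreeAlgebra.lift k X p

/-- The block bidiagonal point of size `(ℓ + 1) s` with `Y` in the diagonal blocks and
`Z^1, …, Z^ℓ` in the blocks directly above the diagonal. -/
def bidiag {s ℓ : ℕ} (Y : Point k g s) (Z : Fin ℓ → Point k g s) : Point k g ((ℓ + 1) * s) :=
  fun j => Matrix.reindex finProdFinEquiv finProdFinEquiv
    (Matrix.of fun (a b : Fin (ℓ + 1) × Fin s) =>
      if a.1 = b.1 then Y j a.2 b.2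
      else if hb : a.1.val + 1 = b.1.val then
        Z ⟨a.1.val, by have := b.1.isLt; omega⟩ j a.2 b.2
      else 0)

/-- The upper right `s × s` block of a matrix of size `(ℓ + 1) s`. -/
def topRight {s ℓ : ℕ} (M : Matrix (Fin ((ℓ + 1) * s)) (Fin ((ℓ + 1) * s)) k) :
    Matrix (Fin s) (Fin s) k :=
  Matrix.of fun a b => M (finProdFinEquiv ((0 : Fin (ℓ + 1)), a)) (finProdFinEquiv (Fin.last ℓ, b))

/-- The `ℓ`-linear map `T` is the `ℓ`-th nc differential `Δ^ℓ_Y f` of `f` at `Y`: for all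
`Z^1, …, Z^ℓ` such that the block bidiagonal point `X` with diagonal `Y` and superdiagonal
`Z^1, …, Z^ℓ` lies in `Ω`, the upper right block of `f(X)` is `T (Z^1, …, Z^ℓ)`. If `Ω` is right
admissible and `Y ∈ Ω`, then every `(Z^1, …, Z^ℓ)` satisfies this after multiplying each `Z^i` by a
nonzero scalar, so at most one multilinear `T` has this property. For `ℓ = 0` it is `f(Y)`. -/
def IsNCDifferential (Ω : ∀ n : ℕ, Set (Point k g n))
    (f : ∀ n : ℕ, Point k g n → Matrix (Fin n) (Fin n) k)
    {s ℓ : ℕ} (Y : Point k g s) (T : MultiMap k g s ℓ) : Prop :=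
  ∀ Z : Fin ℓ → Point k g s, bidiag Y Z ∈ Ω ((ℓ + 1) * s) →
    topRight (f ((ℓ + 1) * s) (bidiag Y Z)) = T Z

end Algebra

end FreeNC

/-! A point `Y` turns `k^s` into a module over the free algebra A. The differentials at `Y` of all
polynomials form the A-orbit of one sequence, `oneSeq`, when x_j acts by the Leibniz recursion
Δ^(m+1)(x_j p)(Z) = Y_j Δ^(m+1)p(Z) + Z^1_j Δ^m p(Z^2, …). This is `polyDiff`, and
`topRight_evalPoly_bidiag` matches it with the upper right block of a bidiagonal evaluation.

Interpolation at one point goes by induction on the order (`exists_polyDiff_eq`). Subtracting a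
polynomial that is right in lower orders leaves a leading term G that kills brackets [S, Y] and is
balanced over the centralizer of `Y`. A product q_1⋯q_L of polynomials vanishing at `Y` has zero
differentials below order L, and Dq_1(Z^1)⋯Dq_L(Z^L) in order L, so G has to be an A-combination of
such products. Semisimplicity enters twice. By splitting a module extension,
`exists_balanced_of_deriv_eq_zero` shows that linear relations among the products come only from
balancing and brackets, so G factors through the products (`IsBalanced.exists_factor`). A double
centralizer argument in `exists_polyDiff_eq_of_gap_eq` then produces coefficients in A. Separated
points are glued by polynomials obtained from Jacobson density.

For an nc function f the argument is different. Since f respects intertwiners, f(X)w lies in Aw as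
soon as Aw is the kernel of an intertwiner into a tuple where f has a value (`IsResolvable`).
Semisimple points of Ω have this property for all invariant subspaces, and admissibility carries it
to extensions, hence to bidiagonal points and their finite direct sums. On a direct sum, a single
vector encodes finitely many interpolation conditions. Finitely many conditions suffice, because the
differentials up to order L lie in a finite-dimensional space. -/

namespace FreeNC

/-! ### Evaluation of polynomials on tuples of endomorphisms -/

section Action

variable {k : Type*} [Field k] {g : ℕ}
  {W W' : Type*} [AddCommGroup W] [Module k W] [AddCommGroup W'] [Module k W']

/-- The action of a polynomial on a space with a tuple of endomorphisms. -/
noncomputable def act (X : Fin g → Module.End k W) (p : FreeAlgebra k (Fin g)) : Module.End k W :=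
  FreeAlgebra.lift k X p

@[simp] lemma act_ι (X : Fin g → Module.End k W) (j : Fin g) : act X (FreeAlgebra.ι k j) = X j := by
  simp [act]

@[simp] lemma act_mul (X : Fin g → Module.End k W) (p q : FreeAlgebra k (Fin g)) (w : W) :
    act X (p * q) w = act X p (act X q w) := by
  simp [act]

@[simp] lemma act_add (X : Fin g → Module.End k W) (p q : FreeAlgebra k (Fin g)) :
    act X (p + q) = act X p + act X q := map_add _ _ _

@[simp] lemma act_sub (X : Fin g → Module.End k W) (p q : FreeAlgebra k (Fin g)) :
    act X (p - q) = act X p - act X q := map_sub _ _ _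

@[simp] lemma act_one (X : Fin g → Module.End k W) : act X 1 = 1 := map_one _

@[simp] lemma act_sum {ι : Type*} (X : Fin g → Module.End k W) (t : Finset ι)
    (p : ι → FreeAlgebra k (Fin g)) : act X (∑ i ∈ t, p i) = ∑ i ∈ t, act X (p i) := map_sum _ _ _

@[simp] lemma act_smul (X : Fin g → Module.End k W) (c : k) (p : FreeAlgebra k (Fin g)) :
    act X (c • p) = c • act X p := map_smul (FreeAlgebra.lift k X) c p

@[simp] lemma act_algebraMap (X : Fin g → Module.End k W) (c : k) (w : W) :
    act X (algebraMap k _ c) w = c • w := by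
  simp [act, Module.algebraMap_end_apply]

lemma act_intertwine {X : Fin g → Module.End k W} {X' : Fin g → Module.End k W'}
    (S : W →ₗ[k] W') (h : ∀ j w, S (X j w) = X' j (S w)) (p : FreeAlgebra k (Fin g)) (w : W) :
    S (act X p w) = act X' p (S w) := by
  induction p generalizing w with
  | grade0 c => simp
  | grade1 j => simp [h]
  | mul p q hp hq => simp [hp, hq]
  | add p q hp hq => simp [hp, hq]

lemma act_mem {X : Fin g → Module.End k W} (U : Submodule k W) (h : ∀ j, ∀ w ∈ U, X j w ∈ U)
    (p : FreeAlgebra k (Fin g)) (w : W) (hw : w ∈ U) : act X p w ∈ U := by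
  induction p generalizing w with
  | grade0 c => simpa using U.smul_mem c hw
  | grade1 j => simpa using h j w hw
  | mul p q hp hq => simpa using hp _ (hq _ hw)
  | add p q hp hq => simpa using U.add_mem (hp _ hw) (hq _ hw)

/-- The endomorphisms of `k^n` given by the matrices of a point. -/
def pointOp {n : ℕ} (Y : Point k g n) (j : Fin g) : Module.End k (Fin n → k) := (Y j).mulVecLin

@[simp] lemma pointOp_apply {n : ℕ} (Y : Point k g n) (j : Fin g) (v : Fin n → k) :
    pointOp Y j v = (Y j).mulVec v := rfl

lemma evalPoly_mulVec {n : ℕ} (p : FreeAlgebra k (Fin g)) (Y : Point k g n) (v : Fin n → k) :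
    (evalPoly p n Y).mulVec v = act (pointOp Y) p v := by
  induction p generalizing v with
  | grade0 c => simp [evalPoly, Algebra.algebraMap_eq_smul_one, Matrix.smul_mulVec]
  | grade1 j => simp [evalPoly]
  | mul p q hp hq => simp [← hp, ← hq, evalPoly, Matrix.mulVec_mulVec]
  | add p q hp hq => simp [← hp, ← hq, evalPoly, Matrix.add_mulVec]

end Action

/-! ### Formal differentials of polynomials and their compatibility conditions -/

section Differentials

variable {k : Type*} [Field k] {g s : ℕ}

lemma gapLeft_zero {m : ℕ} (f : MultiMap k g s m) (S : Matrix (Fin s) (Fin s) k)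
    (Z : Fin m → Point k g s) : gapLeft f 0 S Z = S * f Z := rfl

lemma gapLeft_succ {m : ℕ} (f : MultiMap k g s m) (j : Fin m) (S : Matrix (Fin s) (Fin s) k)
    (Z : Fin m → Point k g s) :
    gapLeft f j.succ S Z = f (Function.update Z j (rmul (Z j) S)) := rfl

lemma gapRight_last {m : ℕ} (f : MultiMap k g s m) (S : Matrix (Fin s) (Fin s) k)
    (Z : Fin m → Point k g s) : gapRight f (Fin.last m) S Z = f Z * S := by
  simp [gapRight]

lemma gapRight_castSucc {m : ℕ} (f : MultiMap k g s m) (j : Fin m) (S : Matrix (Fin s) (Fin s) k)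
    (Z : Fin m → Point k g s) :
    gapRight f j.castSucc S Z = f (Function.update Z j (lmul S (Z j))) := by
  simp [gapRight]

variable (k g s) in
/-- Sequences of `ℓ`-linear maps, `ℓ = 0, 1, 2, …`. -/
abbrev Seq : Type _ := ∀ ℓ : ℕ, MultiMap k g s ℓ

/-- `(z, Z¹, …, Z^m) ↦ z_j f(Z¹, …, Z^m)`. -/
noncomputable def consMul (j : Fin g) {m : ℕ} (f : MultiMap k g s m) : MultiMap k g s (m + 1) :=
  LinearMap.uncurryLeft (M := fun _ : Fin (m + 1) => Point k g s)
    { toFun := fun z => (LinearMap.mulLeft k (z j)).compMultilinearMap f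
      map_add' := fun z z' => MultilinearMap.ext fun Z => by simp [add_mul]
      map_smul' := fun c z => MultilinearMap.ext fun Z => by simp }

@[simp] lemma consMul_apply (j : Fin g) {m : ℕ} (f : MultiMap k g s m)
    (Z : Fin (m + 1) → Point k g s) : consMul j f Z = Z 0 j * f (Fin.tail Z) := rfl

/-- Multiplication by the variable `x_j` on the sequences of differentials at `Y`. -/
noncomputable def varMul (Y : Point k g s) (j : Fin g) : Module.End k (Seq k g s) where
  toFun F := fun ℓ => match ℓ with
    | 0 => (LinearMap.mulLeft k (Y j)).compMultilinearMap (F 0)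
    | m + 1 => (LinearMap.mulLeft k (Y j)).compMultilinearMap (F (m + 1)) + consMul j (F m)
  map_add' F G := by
    funext ℓ
    cases ℓ
    · exact MultilinearMap.ext fun Z => by simp
    · exact MultilinearMap.ext fun Z => by simp [mul_add]; abel
  map_smul' c F := by
    funext ℓ
    cases ℓ
    · exact MultilinearMap.ext fun Z => by simp
    · exact MultilinearMap.ext fun Z => by simp

@[simp] lemma varMul_zero (Y : Point k g s) (j : Fin g) (F : Seq k g s) (Z : Fin 0 → Point k g s) :
    varMul Y j F 0 Z = Y j * F 0 Z := rfl

@[simp] lemma varMul_succ (Y : Point k g s) (j : Fin g) (F : Seq k g s) (m : ℕ)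
    (Z : Fin (m + 1) → Point k g s) :
    varMul Y j F (m + 1) Z = Y j * F (m + 1) Z + Z 0 j * F m (Fin.tail Z) := rfl

variable (k g s) in
/-- The differentials of the constant polynomial `1`. -/
noncomputable def oneSeq : Seq k g s := fun ℓ => match ℓ with
  | 0 => MultilinearMap.constOfIsEmpty k _ 1
  | _ + 1 => 0

@[simp] lemma oneSeq_zero (Z : Fin 0 → Point k g s) : oneSeq k g s 0 Z = 1 := rfl

@[simp] lemma oneSeq_succ (m : ℕ) : oneSeq k g s (m + 1) = 0 := rfl

/-- The sequence of all differentials at `Y` of a polynomial. -/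
noncomputable def polyDiff (Y : Point k g s) (p : FreeAlgebra k (Fin g)) : Seq k g s :=
  act (varMul Y) p (oneSeq k g s)

/-- The linear compatibility conditions of all orders. -/
def LAC (Y : Point k g s) (F : Seq k g s) : Prop :=
  ∀ (m : ℕ) (t : Fin (m + 1)) (S : Matrix (Fin s) (Fin s) k) (Z : Fin m → Point k g s),
    F (m + 1) (Fin.insertNth (α := fun _ => Point k g s) t (bracket S Y) Z)
      = gapLeft (F m) t S Z - gapRight (F m) t S Z

lemma gapLeft_add {m : ℕ} (f f' : MultiMap k g s m) (t : Fin (m + 1)) (S : Matrix (Fin s) (Fin s) k)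
    (Z : Fin m → Point k g s) : gapLeft (f + f') t S Z = gapLeft f t S Z + gapLeft f' t S Z := by
  cases t using Fin.cases <;> simp [gapLeft_zero, gapLeft_succ, mul_add]

lemma gapRight_add {m : ℕ} (f f' : MultiMap k g s m) (t : Fin (m + 1))
    (S : Matrix (Fin s) (Fin s) k) (Z : Fin m → Point k g s) :
    gapRight (f + f') t S Z = gapRight f t S Z + gapRight f' t S Z := by
  cases t using Fin.lastCases <;> simp [gapRight_last, gapRight_castSucc, add_mul]

lemma gapLeft_smul {m : ℕ} (c : k) (f : MultiMap k g s m) (t : Fin (m + 1))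
    (S : Matrix (Fin s) (Fin s) k) (Z : Fin m → Point k g s) :
    gapLeft (c • f) t S Z = c • gapLeft f t S Z := by
  cases t using Fin.cases <;> simp [gapLeft_zero, gapLeft_succ]

lemma gapRight_smul {m : ℕ} (c : k) (f : MultiMap k g s m) (t : Fin (m + 1))
    (S : Matrix (Fin s) (Fin s) k) (Z : Fin m → Point k g s) :
    gapRight (c • f) t S Z = c • gapRight f t S Z := by
  cases t using Fin.lastCases <;> simp [gapRight_last, gapRight_castSucc]

lemma gapLeft_varMul (Y : Point k g s) (j : Fin g) (F : Seq k g s) (m : ℕ) (t : Fin (m + 1))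
    (S : Matrix (Fin s) (Fin s) k) (Z : Fin (m + 1) → Point k g s) :
    gapLeft (varMul Y j F (m + 1)) t.succ S Z
      = Y j * gapLeft (F (m + 1)) t.succ S Z + Z 0 j * gapLeft (F m) t S (Fin.tail Z) := by
  cases t using Fin.cases with
  | zero =>
    rw [gapLeft_succ, gapLeft_succ, gapLeft_zero, varMul_succ, Fin.tail_update_zero]
    simp [rmul, mul_assoc]
  | succ i =>
    rw [gapLeft_succ, gapLeft_succ, gapLeft_succ, varMul_succ, Fin.tail_update_succ,
      Function.update_of_ne (Fin.succ_ne_zero i).symm]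
    simp [Fin.tail]

lemma gapRight_varMul (Y : Point k g s) (j : Fin g) (F : Seq k g s) (m : ℕ) (t : Fin (m + 1))
    (S : Matrix (Fin s) (Fin s) k) (Z : Fin (m + 1) → Point k g s) :
    gapRight (varMul Y j F (m + 1)) t.succ S Z
      = Y j * gapRight (F (m + 1)) t.succ S Z + Z 0 j * gapRight (F m) t S (Fin.tail Z) := by
  cases t using Fin.lastCases with
  | last =>
    rw [Fin.succ_last, gapRight_last, gapRight_last, gapRight_last, varMul_succ]
    simp [add_mul, mul_assoc]
  | cast i =>
    rw [Fin.succ_castSucc, gapRight_castSucc, gapRight_castSucc, gapRight_castSucc, varMul_succ,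
      Fin.tail_update_succ,
      Function.update_of_ne (Fin.succ_ne_zero i).symm]
    simp [Fin.tail]

lemma LAC.add {Y : Point k g s} {F G : Seq k g s} (hF : LAC Y F) (hG : LAC Y G) :
    LAC Y (F + G) := by
  intro m t S Z
  simp only [Pi.add_apply, gapLeft_add, gapRight_add, add_apply, hF m, hG m]
  abel

lemma LAC.smul {Y : Point k g s} {F : Seq k g s} (hF : LAC Y F) (c : k) : LAC Y (c • F) := by
  intro m t S Z
  simp only [Pi.smul_apply, gapLeft_smul, gapRight_smul, smul_apply, hF m, smul_sub]

/-- With the bracket in the first slot, the new term (S Y_j - Y_j S) F_m turns Y_j S F_m into S Y_j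
F_m, and the terms with S Z^1_j cancel. With the bracket in a later slot, the conditions on `F` in
two consecutive orders add up. -/
lemma LAC.varMul {Y : Point k g s} {F : Seq k g s} (hF : LAC Y F) (j : Fin g) :
    LAC Y (varMul Y j F) := by
  intro m t S Z
  cases t using Fin.cases with
  | zero =>
    have h := hF m 0 S Z
    rw [varMul_succ, h, gapLeft_zero, gapLeft_zero]
    have h2 : Fin.tail (Fin.insertNth (α := fun _ => Point k g s) 0 (bracket S Y) Z) = Z := by
      simp
    have h3 : Fin.insertNth (α := fun _ => Point k g s) 0 (bracket S Y) Z 0 j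
      = S * Y j - Y j * S := by simp [bracket]
    rw [h2, h3]
    cases m with
    | zero =>
      have h0 : (0 : Fin (0 + 1)) = Fin.last 0 := rfl
      rw [h0, gapRight_last, gapRight_last, varMul_zero]
      noncomm_ring
    | succ m =>
      have h0 : (0 : Fin (m + 1 + 1)) = (0 : Fin (m + 1)).castSucc := rfl
      rw [h0, gapRight_castSucc, gapRight_castSucc, varMul_succ, varMul_succ,
        Fin.tail_update_zero]
      simp only [Function.update_self, lmul]
      noncomm_ring
  | succ t =>
    cases m with
    | zero => exact t.elim0
    | succ m =>
      have h2 : Fin.tail (Fin.insertNth (α := fun _ => Point k g s) t.succ (bracket S Y) Z)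
          = Fin.insertNth (α := fun _ => Point k g s) t (bracket S Y) (Fin.tail Z) := by
        refine Fin.eq_insertNth_iff.mpr ⟨by simp [Fin.tail], funext fun i => ?_⟩
        simp only [Fin.removeNth, Fin.tail]
        rw [← Fin.succ_succAbove_succ, Fin.insertNth_apply_succAbove]
      have h3 : Fin.insertNth (α := fun _ => Point k g s) t.succ (bracket S Y) Z 0 = Z 0 := by
        rw [← Fin.succ_succAbove_zero t, Fin.insertNth_apply_succAbove]
      rw [varMul_succ, gapLeft_varMul, gapRight_varMul, h2, h3, hF, hF]
      noncomm_ring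

lemma LAC.act {Y : Point k g s} {F : Seq k g s} (hF : LAC Y F) (p : FreeAlgebra k (Fin g)) :
    LAC Y (act (FreeNC.varMul Y) p F) := by
  induction p generalizing F with
  | grade0 c => simpa using hF.smul c
  | grade1 j => simpa using hF.varMul j
  | mul p q hp hq => simpa using hp (hq hF)
  | add p q hp hq => simpa using (hp hF).add (hq hF)

lemma lac_oneSeq (Y : Point k g s) : LAC Y (oneSeq k g s) := by
  intro m t S Z
  cases m with
  | zero =>
    obtain rfl : t = 0 := Fin.fin_one_eq_zero t
    have h0 : (0 : Fin (0 + 1)) = Fin.last 0 := rfl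
    rw [gapLeft_zero]
    rw [h0, gapRight_last]
    simp
  | succ m =>
    have hl : gapLeft (oneSeq k g s (m + 1)) t S Z = 0 := by
      cases t using Fin.cases <;> simp [gapLeft_zero, gapLeft_succ]
    have hr : gapRight (oneSeq k g s (m + 1)) t S Z = 0 := by
      cases t using Fin.lastCases <;> simp [gapRight_last, gapRight_castSucc]
    rw [hl, hr]
    simp

lemma lac_polyDiff (Y : Point k g s) (p : FreeAlgebra k (Fin g)) : LAC Y (polyDiff Y p) :=
  (lac_oneSeq Y).act p

/-- For a centralizing `S` the bracket is a zero argument, so the condition of the next order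
degenerates to invariance. -/
lemma LAC.gap_eq {Y : Point k g s} {F : Seq k g s} (hF : LAC Y F) {S : Matrix (Fin s) (Fin s) k}
    (hS : ∀ j, S * Y j = Y j * S) (m : ℕ) (t : Fin (m + 1)) (Z : Fin m → Point k g s) :
    gapLeft (F m) t S Z = gapRight (F m) t S Z := by
  have h := hF m t S Z
  have hb : bracket S Y = 0 := by funext j; simp [bracket, hS]
  rw [hb, MultilinearMap.map_coord_zero _ t (by simp)] at h
  exact (sub_eq_zero.mp h.symm)

lemma update_fin_one {α : Type*} (z z' : α) :
    Function.update (fun _ : Fin 1 => z) 0 z' = fun _ => z' := by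
  funext i; obtain rfl : i = 0 := Subsingleton.elim _ _; simp

/-- The first order differential of a polynomial. -/
noncomputable def derivAt (Y : Point k g s) (p : FreeAlgebra k (Fin g)) :
    Point k g s →ₗ[k] Matrix (Fin s) (Fin s) k where
  toFun z := polyDiff Y p 1 (fun _ => z)
  map_add' z z' := by
    simpa only [update_fin_one] using (polyDiff Y p 1).map_update_add (fun _ => z) 0 z z'
  map_smul' c z := by
    simpa only [update_fin_one, RingHom.id_apply] using
      (polyDiff Y p 1).map_update_smul (fun _ => z) 0 c z

/-- The Leibniz rule on the filtration by order. In particular, a `p` vanishing at `Y` raises the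
order of vanishing by one, with its first derivative as the new left factor. -/
lemma act_varMul_leading (Y : Point k g s) (p : FreeAlgebra k (Fin g)) (n : ℕ) (F : Seq k g s)
    (hF : ∀ ℓ < n, F ℓ = 0) :
    (∀ ℓ < n, act (varMul Y) p F ℓ = 0) ∧
    (∀ Z, act (varMul Y) p F n Z = evalPoly p s Y * F n Z) ∧
    (∀ Z, act (varMul Y) p F (n + 1) Z
      = evalPoly p s Y * F (n + 1) Z + derivAt Y p (Z 0) * F n (Fin.tail Z)) := by
  induction p generalizing F n with
  | grade0 c =>
    refine ⟨fun ℓ hℓ => ?_, fun Z => ?_, fun Z => ?_⟩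
    · simp [hF ℓ hℓ]
    · simp [evalPoly, Algebra.algebraMap_eq_smul_one]
    · simp [evalPoly, Algebra.algebraMap_eq_smul_one, derivAt, polyDiff]
  | grade1 j =>
    refine ⟨fun ℓ hℓ => ?_, fun Z => ?_, fun Z => ?_⟩
    · refine MultilinearMap.ext fun Z => ?_
      cases ℓ with
      | zero => simp [hF 0 hℓ]
      | succ ℓ => simp [hF _ hℓ, hF ℓ (by omega)]
    · cases n with
      | zero => simp [evalPoly]
      | succ n => simp [evalPoly, hF n (by omega)]
    · simp [evalPoly, derivAt, polyDiff]
  | mul p q hp hq =>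
    obtain ⟨q1, q2, q3⟩ := hq n F hF
    obtain ⟨p1, p2, p3⟩ := hp n (act (varMul Y) q F) q1
    -- The product rule is the case n = 0 of the induction hypotheses, applied to `polyDiff Y q`,
    -- whose order zero term is q(Y).
    have hd : ∀ z, derivAt Y (p * q) z
        = evalPoly p s Y * derivAt Y q z + derivAt Y p z * evalPoly q s Y := by
      intro z
      have h1 := (hp 0 (polyDiff Y q) (by simp)).2.2 (fun _ => z)
      have h2 := (hq 0 (oneSeq k g s) (by simp)).2.1 (Fin.tail (n := 0) (fun _ : Fin 1 => z))
      simp only [oneSeq_zero, mul_one] at h2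
      simp only [polyDiff] at h1
      rw [h2] at h1
      simpa [derivAt, polyDiff] using h1
    refine ⟨fun ℓ hℓ => by simp [p1 ℓ hℓ], fun Z => ?_, fun Z => ?_⟩
    · simp [p2, q2, evalPoly, mul_assoc]
    · simp only [act_mul, p3, q3, q2, hd]
      simp only [evalPoly, map_mul]
      noncomm_ring
  | add p q hp hq =>
    obtain ⟨q1, q2, q3⟩ := hq n F hF
    obtain ⟨p1, p2, p3⟩ := hp n F hF
    have hd : ∀ z, derivAt Y (p + q) z = derivAt Y p z + derivAt Y q z := by
      intro z; simp [derivAt, polyDiff]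
    refine ⟨fun ℓ hℓ => by simp [p1 ℓ hℓ, q1 ℓ hℓ], fun Z => ?_, fun Z => ?_⟩
    · simp [p2, q2, evalPoly, add_mul]
    · simp only [act_add, LinearMap.add_apply, Pi.add_apply, add_apply, p3, q3, hd]
      simp only [evalPoly, map_add]
      noncomm_ring

lemma derivAt_add (Y : Point k g s) (p q : FreeAlgebra k (Fin g)) (z : Point k g s) :
    derivAt Y (p + q) z = derivAt Y p z + derivAt Y q z := by
  simp [derivAt, polyDiff]

lemma derivAt_algebraMap (Y : Point k g s) (c : k) (z : Point k g s) :
    derivAt Y (algebraMap k _ c) z = 0 := by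
  simp [derivAt, polyDiff]

lemma derivAt_ι (Y : Point k g s) (j : Fin g) (z : Point k g s) :
    derivAt Y (FreeAlgebra.ι k j) z = z j := by
  simp [derivAt, polyDiff]

lemma derivAt_mul (Y : Point k g s) (p q : FreeAlgebra k (Fin g)) (z : Point k g s) :
    derivAt Y (p * q) z = evalPoly p s Y * derivAt Y q z + derivAt Y p z * evalPoly q s Y := by
  have h1 := (act_varMul_leading Y p 0 (polyDiff Y q) (by simp)).2.2 (fun _ => z)
  have h2 := (act_varMul_leading Y q 0 (oneSeq k g s) (by simp)).2.1
    (Fin.tail (n := 0) (fun _ : Fin 1 => z))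
  simp only [oneSeq_zero, mul_one] at h2
  simp only [polyDiff] at h1
  rw [h2] at h1
  simpa [derivAt, polyDiff] using h1

lemma derivAt_lmul {Y : Point k g s} {S : Matrix (Fin s) (Fin s) k}
    (hS : ∀ j, S * Y j = Y j * S) (p : FreeAlgebra k (Fin g)) (z : Point k g s) :
    derivAt Y p (lmul S z) = S * derivAt Y p z := by
  have h := (lac_polyDiff Y p).gap_eq hS 1 0 (fun _ => z)
  have h0 : (0 : Fin (1 + 1)) = (0 : Fin 1).castSucc := rfl
  rw [gapLeft_zero, h0, gapRight_castSucc] at h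
  rw [derivAt]
  simp only [LinearMap.coe_mk, AddHom.coe_mk]
  rw [h]
  rw [update_fin_one]

end Differentials

end FreeNC
namespace FreeNC

/-! ### Bidiagonal points and the identification of `polyDiff` with nc differentials -/

section Chain

variable {k : Type*} [Field k] {g s : ℕ}

/-- The block bidiagonal operator on `(k^s)^(ℓ+1)`. -/
def chainOp (Y : Point k g s) {ℓ : ℕ} (Z : Fin ℓ → Point k g s) (j : Fin g) :
    Module.End k (Fin (ℓ + 1) → Fin s → k) where
  toFun w a := (Y j).mulVec (w a) +
    Fin.snoc (α := fun _ => Fin s → k) (fun i => (Z i j).mulVec (w i.succ)) 0 a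
  map_add' w w' := by
    funext a
    cases a using Fin.lastCases with
    | last => simp [Matrix.mulVec_add]
    | cast i => simp only [Pi.add_apply, Matrix.mulVec_add, Fin.snoc_castSucc]; abel
  map_smul' c w := by
    funext a
    cases a using Fin.lastCases with
    | last => simp [Matrix.mulVec_smul]
    | cast i => simp [Matrix.mulVec_smul, Fin.snoc_castSucc]

lemma chainOp_apply (Y : Point k g s) {ℓ : ℕ} (Z : Fin ℓ → Point k g s) (j : Fin g)
    (w : Fin (ℓ + 1) → Fin s → k) (a : Fin (ℓ + 1)) :
    chainOp Y Z j w a = (Y j).mulVec (w a) +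
      Fin.snoc (α := fun _ => Fin s → k) (fun i => (Z i j).mulVec (w i.succ)) 0 a := rfl

lemma chainOp_last (Y : Point k g s) {ℓ : ℕ} (Z : Fin ℓ → Point k g s) (j : Fin g)
    (w : Fin (ℓ + 1) → Fin s → k) :
    chainOp Y Z j w (Fin.last ℓ) = (Y j).mulVec (w (Fin.last ℓ)) := by
  simp [chainOp_apply]

lemma chainOp_castSucc (Y : Point k g s) {ℓ : ℕ} (Z : Fin ℓ → Point k g s) (j : Fin g)
    (w : Fin (ℓ + 1) → Fin s → k) (i : Fin ℓ) :
    chainOp Y Z j w i.castSucc = (Y j).mulVec (w i.castSucc) + (Z i j).mulVec (w i.succ) := by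
  simp [chainOp_apply]

lemma chainOp_cons (Y : Point k g s) {ℓ : ℕ} (Z : Fin (ℓ + 1) → Point k g s) (j : Fin g)
    (v : Fin s → k) (w : Fin (ℓ + 1) → Fin s → k) :
    chainOp Y Z j (Fin.cons (α := fun _ => Fin s → k) v w)
      = Fin.cons (α := fun _ => Fin s → k) ((Y j).mulVec v + (Z 0 j).mulVec (w 0))
          (chainOp Y (Fin.tail Z) j w) := by
  funext a
  cases a using Fin.cases with
  | zero =>
    rw [show (0 : Fin (ℓ + 1 + 1)) = (0 : Fin (ℓ + 1)).castSucc from rfl, chainOp_castSucc]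
    simp
  | succ a =>
    cases a using Fin.lastCases with
    | last => rw [Fin.succ_last, chainOp_last, ← Fin.succ_last, Fin.cons_succ, Fin.cons_succ,
        chainOp_last]
    | cast i =>
      rw [Fin.succ_castSucc, chainOp_castSucc, ← Fin.succ_castSucc, Fin.cons_succ, Fin.cons_succ,
        Fin.cons_succ, chainOp_castSucc]
      rfl

variable (k s) in
/-- Splitting a vector of size `(ℓ + 1) s` into `ℓ + 1` blocks. -/
def blocks (ℓ : ℕ) : (Fin ((ℓ + 1) * s) → k) ≃ₗ[k] (Fin (ℓ + 1) → Fin s → k) :=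
  (LinearEquiv.funCongrLeft k k finProdFinEquiv).trans
    (LinearEquiv.curry k k (Fin (ℓ + 1)) (Fin s))

@[simp] lemma blocks_apply {ℓ : ℕ} (v : Fin ((ℓ + 1) * s) → k) (a : Fin (ℓ + 1)) (b : Fin s) :
    blocks k s ℓ v a b = v (finProdFinEquiv (a, b)) := rfl

lemma blocks_bidiag (Y : Point k g s) {ℓ : ℕ} (Z : Fin ℓ → Point k g s) (j : Fin g)
    (v : Fin ((ℓ + 1) * s) → k) :
    blocks k s ℓ (pointOp (bidiag Y Z) j v) = chainOp Y Z j (blocks k s ℓ v) := by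
  funext a b
  have h1 : blocks k s ℓ (pointOp (bidiag Y Z) j v) a b
      = ∑ c, ∑ d, (if a = c then Y j b d
        else if hb : a.val + 1 = c.val then Z ⟨a.val, by have := c.isLt; omega⟩ j b d else 0)
          * v (finProdFinEquiv (c, d)) := by
    rw [blocks_apply, pointOp_apply, Matrix.mulVec, dotProduct,
      ← finProdFinEquiv.sum_comp, Fintype.sum_prod_type]
    simp [bidiag]
  rw [h1]
  cases a using Fin.lastCases with
  | last =>
    rw [chainOp_last, Finset.sum_eq_single (Fin.last ℓ)]
    · simp [Matrix.mulVec, dotProduct]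
    · intro c _ hc
      refine Finset.sum_eq_zero fun d _ => ?_
      have := c.isLt
      rw [if_neg hc.symm, dif_neg (by simp only [Fin.val_last]; omega), zero_mul]
    · simp
  | cast i =>
    rw [chainOp_castSucc, ← Finset.sum_subset (Finset.subset_univ {i.castSucc, i.succ}),
      Finset.sum_pair (Fin.castSucc_lt_succ).ne]
    · simp [Matrix.mulVec, dotProduct, (Fin.castSucc_lt_succ (i := i)).ne]
    · intro c _ hc
      simp only [Finset.mem_insert, Finset.mem_singleton, not_or] at hc
      refine Finset.sum_eq_zero fun d _ => ?_
      rw [if_neg (Ne.symm hc.1), dif_neg, zero_mul]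
      intro h
      exact hc.2 (Fin.ext (by simpa using h.symm))

/-- The column vector of the values of a sequence of differentials along the chain `Z`. -/
def chainVec (η : Fin s → k) : ∀ (ℓ : ℕ), (Fin ℓ → Point k g s) → Seq k g s →
    (Fin (ℓ + 1) → Fin s → k)
  | 0, Z, F => fun _ => (F 0 Z).mulVec η
  | ℓ + 1, Z, F => Fin.cons ((F (ℓ + 1) Z).mulVec η) (chainVec η ℓ (Fin.tail Z) F)

lemma chainVec_zero (η : Fin s → k) (ℓ : ℕ) (Z : Fin ℓ → Point k g s) (F : Seq k g s) :
    chainVec η ℓ Z F 0 = (F ℓ Z).mulVec η := by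
  cases ℓ <;> rfl

/-- `chainVec` as a linear map. -/
def chainVecₗ (η : Fin s → k) (ℓ : ℕ) (Z : Fin ℓ → Point k g s) :
    Seq k g s →ₗ[k] (Fin (ℓ + 1) → Fin s → k) where
  toFun := chainVec η ℓ Z
  map_add' F G := by
    induction ℓ with
    | zero => funext a; simp [chainVec, Matrix.add_mulVec]
    | succ ℓ ih =>
      funext a
      cases a using Fin.cases <;> simp [chainVec, Matrix.add_mulVec, ih]
  map_smul' c F := by
    induction ℓ with
    | zero => funext a; simp [chainVec, Matrix.smul_mulVec]
    | succ ℓ ih =>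
      funext a
      cases a using Fin.cases <;> simp [chainVec, Matrix.smul_mulVec, ih]

/-- The recursion defining `varMul` is the first block row of the bidiagonal operator. Hence
`chainVec` intertwines the two A-actions, and it sends `oneSeq` to `η` in the last block. -/
lemma chainVec_varMul (η : Fin s → k) (Y : Point k g s) (j : Fin g) (ℓ : ℕ)
    (Z : Fin ℓ → Point k g s) (F : Seq k g s) :
    chainVec η ℓ Z (varMul Y j F) = chainOp Y Z j (chainVec η ℓ Z F) := by
  induction ℓ with
  | zero =>
    funext a
    obtain rfl : a = Fin.last 0 := Fin.fin_one_eq_zero a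
    rw [chainOp_last]
    simp [chainVec]
  | succ ℓ ih =>
    rw [chainVec, chainVec, chainOp_cons, ih, chainVec_zero]
    simp [Matrix.add_mulVec]

lemma chainVec_oneSeq (η : Fin s → k) (ℓ : ℕ) (Z : Fin ℓ → Point k g s) :
    chainVec η ℓ Z (oneSeq k g s) = Pi.single (Fin.last ℓ) η := by
  induction ℓ with
  | zero =>
    funext a
    obtain rfl : a = Fin.last 0 := Fin.fin_one_eq_zero a
    simp [chainVec]
  | succ ℓ ih =>
    funext a
    cases a using Fin.cases with
    | zero => simp [chainVec]
    | succ a =>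
      rw [chainVec, Fin.cons_succ, ih, ← Fin.succ_last]
      simp only [Pi.single_apply, Fin.succ_inj]

lemma topRight_apply {ℓ : ℕ} (M : Matrix (Fin ((ℓ + 1) * s)) (Fin ((ℓ + 1) * s)) k)
    (a b : Fin s) :
    topRight M a b = blocks k s ℓ (M.mulVec ((blocks k s ℓ).symm
      (Pi.single (Fin.last ℓ) (Pi.single b 1)))) 0 a := by
  have : (blocks k s ℓ).symm (Pi.single (Fin.last ℓ) (Pi.single b 1))
      = Pi.single (finProdFinEquiv (Fin.last ℓ, b)) 1 := by
    rw [LinearEquiv.symm_apply_eq]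
    funext c d
    rw [blocks_apply]
    by_cases hc : c = Fin.last ℓ
    · subst hc; simp [Pi.single_apply]
    · simp [hc]
  rw [this]
  simp [topRight]

lemma topRight_evalPoly_bidiag (Y : Point k g s) (p : FreeAlgebra k (Fin g)) {ℓ : ℕ}
    (Z : Fin ℓ → Point k g s) :
    topRight (evalPoly p ((ℓ + 1) * s) (bidiag Y Z)) = polyDiff Y p ℓ Z := by
  ext a b
  have hb := act_intertwine (blocks k s ℓ).toLinearMap (blocks_bidiag Y Z) p
  simp only [LinearEquiv.coe_coe] at hb
  rw [topRight_apply, evalPoly_mulVec, hb, LinearEquiv.apply_symm_apply, ← chainVec_oneSeq _ ℓ Z]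
  have := act_intertwine (chainVecₗ (Pi.single b 1) ℓ Z) (X := varMul Y) (X' := chainOp Y Z)
    (fun j F => chainVec_varMul _ Y j ℓ Z F) p (oneSeq k g s)
  have h2 := congrFun (congrFun this 0) a
  simp only [chainVecₗ, LinearMap.coe_mk, AddHom.coe_mk, chainVec_zero] at h2
  rw [← h2]
  simp [polyDiff]

lemma isNCDifferential_evalPoly (Y : Point k g s) (p : FreeAlgebra k (Fin g)) (ℓ : ℕ) :
    IsNCDifferential (fun _ => Set.univ) (evalPoly p) Y (polyDiff Y p ℓ) :=
  fun Z _ => topRight_evalPoly_bidiag Y p Z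

end Chain

end FreeNC
namespace FreeNC

/-! ### Points as modules over the free algebra -/

section Modules

variable {k : Type*} [Field k] {g : ℕ}

/-- A space with a tuple of endomorphisms, as a module over the free algebra. -/
def NCMod {W : Type*} [AddCommGroup W] [Module k W] (_X : Fin g → Module.End k W) : Type _ := W

namespace NCMod

variable {W W' : Type*} [AddCommGroup W] [Module k W] [AddCommGroup W'] [Module k W']
  {X : Fin g → Module.End k W} {X' : Fin g → Module.End k W'}

instance : AddCommGroup (NCMod X) := inferInstanceAs (AddCommGroup W)

instance : Module k (NCMod X) := inferInstanceAs (Module k W)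

noncomputable instance : Module (FreeAlgebra k (Fin g)) (NCMod X) :=
  Module.compHom W (FreeAlgebra.lift k X).toRingHom

variable (X) in
/-- The underlying space of the module given by a tuple of endomorphisms. -/
def toMod : W ≃ₗ[k] NCMod X := LinearEquiv.refl k W

lemma smul_def (p : FreeAlgebra k (Fin g)) (w : NCMod X) :
    p • w = toMod X (act X p ((toMod X).symm w)) := rfl

instance : IsScalarTower k (FreeAlgebra k (Fin g)) (NCMod X) where
  smul_assoc c p w := by simp [smul_def]

lemma smul_toMod (p : FreeAlgebra k (Fin g)) (w : W) :
    p • toMod X w = toMod X (act X p w) := rfl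

/-- Module homomorphisms as linear maps between the underlying spaces. -/
noncomputable def toLin (φ : NCMod X →ₗ[FreeAlgebra k (Fin g)] NCMod X') : W →ₗ[k] W' :=
  (toMod X').symm.toLinearMap ∘ₗ φ.restrictScalars k ∘ₗ (toMod X).toLinearMap

lemma toMod_toLin (φ : NCMod X →ₗ[FreeAlgebra k (Fin g)] NCMod X') (w : W) :
    toMod X' (toLin φ w) = φ (toMod X w) := rfl

lemma toLin_intertwine (φ : NCMod X →ₗ[FreeAlgebra k (Fin g)] NCMod X') (j : Fin g) (w : W) :
    toLin φ (X j w) = X' j (toLin φ w) := by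
  have := φ.map_smul (FreeAlgebra.ι k j) (toMod X w)
  rw [smul_toMod, act_ι, smul_def, act_ι] at this
  exact this

/-- Invariant subspaces as submodules. -/
def submoduleOf (U : Submodule k W) (h : ∀ j, ∀ w ∈ U, X j w ∈ U) :
    Submodule (FreeAlgebra k (Fin g)) (NCMod X) where
  carrier := {w | (toMod X).symm w ∈ U}
  add_mem' := U.add_mem
  zero_mem' := U.zero_mem
  smul_mem' p _ hw := act_mem U h p _ hw

lemma mem_submoduleOf (U : Submodule k W) (h : ∀ j, ∀ w ∈ U, X j w ∈ U) (w : W) :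
    toMod X w ∈ submoduleOf (X := X) U h ↔ w ∈ U := Iff.rfl

lemma mem_of_submodule (U : Submodule (FreeAlgebra k (Fin g)) (NCMod X)) (j : Fin g) (w : W)
    (hw : toMod X w ∈ U) : toMod X (X j w) ∈ U := by
  have := U.smul_mem (FreeAlgebra.ι k j) hw
  simpa [smul_toMod] using this

end NCMod

open NCMod

/-- The module over the free algebra given by a point. -/
abbrev PtMod {n : ℕ} (Y : Point k g n) : Type _ := NCMod (pointOp Y)

lemma isSimpleModule_of_isIrreduciblePoint {n : ℕ} {Y : Point k g n} (hY : IsIrreduciblePoint Y) :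
    IsSimpleModule (FreeAlgebra k (Fin g)) (PtMod Y) := by
  obtain ⟨hn, hU⟩ := hY
  have : Nonempty (Fin n) := ⟨⟨0, hn⟩⟩
  have : Nontrivial (PtMod Y) := inferInstanceAs (Nontrivial (Fin n → k))
  rw [isSimpleModule_iff]
  refine { exists_pair_ne := ⟨⊥, ⊤, bot_ne_top⟩, eq_bot_or_eq_top := fun U => ?_ }
  let U' : Submodule k (Fin n → k) := (U.restrictScalars k).comap (toMod (pointOp Y)).toLinearMap
  rcases hU U' (fun j v hv => mem_of_submodule U j v hv) with h | h
  · left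
    rw [eq_bot_iff]
    intro w hw
    have : (toMod (pointOp Y)).symm w ∈ U' := hw
    rw [h] at this
    exact this
  · right
    rw [eq_top_iff]
    intro w _
    have : (toMod (pointOp Y)).symm w ∈ U' := h ▸ Submodule.mem_top
    exact this

lemma Similar.exists_equiv {ι ι' : Type} [Fintype ι] [Fintype ι'] [DecidableEq ι']
    {Y : Fin g → Matrix ι ι k} {Y' : Fin g → Matrix ι' ι' k} (h : Similar Y Y') :
    ∃ E : (ι → k) ≃ₗ[k] (ι' → k), ∀ j v, E ((Y j).mulVec v) = (Y' j).mulVec (E v) := by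
  obtain ⟨e, P, hP⟩ := h
  refine ⟨(LinearEquiv.funCongrLeft k k e.symm).trans
    (Matrix.toLin'OfInv P.inv_mul P.mul_inv), fun j v => ?_⟩
  have h1 : (LinearEquiv.funCongrLeft k k e.symm) ((Y j).mulVec v)
      = (Matrix.reindex e e (Y j)).mulVec ((LinearEquiv.funCongrLeft k k e.symm) v) := by
    funext i
    simp [Matrix.mulVec, dotProduct, LinearEquiv.funCongrLeft_apply, LinearMap.funLeft_apply,
      ← e.sum_comp]
  have hT : ∀ u, Matrix.toLin'OfInv P.inv_mul P.mul_inv u = P.val.mulVec u := fun _ => rfl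
  rw [LinearEquiv.trans_apply, LinearEquiv.trans_apply, h1, hT, hT, hP, Matrix.mulVec_mulVec,
    Matrix.mulVec_mulVec, mul_assoc, Units.inv_mul, mul_one]

lemma similar_of_equiv {n n' : ℕ} {Y : Point k g n} {Y' : Point k g n'}
    (E : (Fin n → k) ≃ₗ[k] (Fin n' → k)) (hE : ∀ j v, E ((Y j).mulVec v) = (Y' j).mulVec (E v)) :
    Similar Y Y' := by
  obtain rfl : n = n' := by simpa using E.finrank_eq
  let P := LinearMap.toMatrix' E.toLinearMap
  let Q := LinearMap.toMatrix' E.symm.toLinearMap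
  have hPQ : P * Q = 1 := by
    rw [← LinearMap.toMatrix'_comp]; simp
  have hQP : Q * P = 1 := by
    rw [← LinearMap.toMatrix'_comp]; simp
  have hc : ∀ j, P * Y j = Y' j * P := by
    intro j
    refine Matrix.toLin'.injective (LinearMap.ext fun v => ?_)
    simpa [P, Matrix.toLin'_mul] using hE j v
  refine ⟨Equiv.refl _, ⟨P, Q, hPQ, hQP⟩, fun j => ?_⟩
  simp only [Matrix.reindex_refl_refl, Units.inv_mk]
  rw [hc, mul_assoc, hPQ, mul_one]

lemma IsIrredDecomp.nonempty_equiv {s : ℕ} {Y : Point k g s} {r : ℕ} {n : Fin r → ℕ}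
    {B : ∀ a, Point k g (n a)} (h : IsIrredDecomp Y B) :
    Nonempty (PtMod Y ≃ₗ[FreeAlgebra k (Fin g)] (∀ a, PtMod (B a))) := by
  obtain ⟨E, hE⟩ := h.2.exists_equiv
  have hB : ∀ (j : Fin g) (v : (Σ a, Fin (n a)) → k) (a : Fin r),
      (fun b => (Matrix.blockDiagonal' fun a => B a j).mulVec v ⟨a, b⟩)
        = (B a j).mulVec (fun b => v ⟨a, b⟩) := by
    intro j v a
    funext b
    simp only [Matrix.mulVec, dotProduct, Fintype.sum_sigma]
    rw [Finset.sum_eq_single a]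
    · simp [Matrix.blockDiagonal'_apply]
    · intro a' _ ha'
      exact Finset.sum_eq_zero fun b' _ => by
        rw [Matrix.blockDiagonal'_apply_ne _ _ _ ha'.symm, zero_mul]
    · simp
  let E' : (∀ a, Fin (n a) → k) ≃ₗ[k] (Fin s → k) := (LinearEquiv.piCurry k
    (fun (a : Fin r) (_ : Fin (n a)) => k)).symm.trans E
  have hE' : ∀ j (v : ∀ a, Fin (n a) → k),
      E' (fun a => (B a j).mulVec (v a)) = (Y j).mulVec (E' v) := by
    intro j v
    simp only [E', LinearEquiv.trans_apply]
    rw [← hE]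
    congr 1
    funext x
    have := congrFun (hB j ((LinearEquiv.piCurry k
      (fun (a : Fin r) (_ : Fin (n a)) => k)).symm v) x.1) x.2
    exact this.symm
  refine ⟨LinearEquiv.symm
    { toFun := fun v => toMod (pointOp Y) (E' fun a => (toMod _).symm (v a))
      invFun := fun w a => toMod (pointOp (B a)) (E'.symm ((toMod (pointOp Y)).symm w) a)
      map_add' := ?_
      map_smul' := ?_
      left_inv := ?_
      right_inv := ?_ }⟩
  · intro v w
    rw [← map_add, ← map_add]
    rfl
  · intro p v
    have hs : ∀ u : ∀ a, Fin (n a) → k,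
        E' (fun a => act (pointOp (B a)) p (u a)) = act (pointOp Y) p (E' u) := by
      intro u
      induction p generalizing u with
      | grade0 c =>
        simp only [act_algebraMap]
        exact E'.map_smul c u
      | grade1 j => simpa using hE' j u
      | mul p q hp hq => simp [hp, hq]
      | add p q hp hq =>
        simp only [act_add, LinearMap.add_apply, ← hp, ← hq, ← map_add]
        rfl
    exact hs _
  · intro v; simp
  · intro w; simp

lemma IsSemisimplePoint.isSemisimpleModule {s : ℕ} {Y : Point k g s} (h : IsSemisimplePoint Y) :
    IsSemisimpleModule (FreeAlgebra k (Fin g)) (PtMod Y) := by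
  obtain ⟨r, n, B, hB⟩ := h
  obtain ⟨e⟩ := hB.nonempty_equiv
  have := fun a => isSimpleModule_of_isIrreduciblePoint (hB.1 a)
  exact .congr e

/-- Schur's lemma blockwise: a nonzero component between simple summands would be an isomorphism,
that is, a similarity of irreducible blocks. -/
lemma hom_eq_zero_of_not_similar {s s' : ℕ} {Y : Point k g s} {Y' : Point k g s'}
    (hY : IsSemisimplePoint Y) (hY' : IsSemisimplePoint Y')
    (hns : ∀ (r r' : ℕ) (n : Fin r → ℕ) (n' : Fin r' → ℕ)
      (B : ∀ a, Point k g (n a)) (B' : ∀ a, Point k g (n' a)),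
      IsIrredDecomp Y B → IsIrredDecomp Y' B' → ∀ a a', ¬ Similar (B a) (B' a'))
    (φ : PtMod Y →ₗ[FreeAlgebra k (Fin g)] PtMod Y') : φ = 0 := by
  obtain ⟨r, n, B, hB⟩ := hY
  obtain ⟨r', n', B', hB'⟩ := hY'
  obtain ⟨e⟩ := hB.nonempty_equiv
  obtain ⟨e'⟩ := hB'.nonempty_equiv
  let ψ : (∀ a, PtMod (B a)) →ₗ[FreeAlgebra k (Fin g)] (∀ a, PtMod (B' a)) :=
    e'.toLinearMap ∘ₗ φ ∘ₗ e.symm.toLinearMap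
  have hψ : ψ = 0 := by
    refine LinearMap.pi_ext' fun a => LinearMap.ext fun x => funext fun a' => ?_
    let χ : PtMod (B a) →ₗ[FreeAlgebra k (Fin g)] PtMod (B' a') :=
      LinearMap.proj a' ∘ₗ ψ ∘ₗ LinearMap.single (FreeAlgebra k (Fin g)) (fun a => PtMod (B a)) a
    have := isSimpleModule_of_isIrreduciblePoint (hB.1 a)
    have := isSimpleModule_of_isIrreduciblePoint (hB'.1 a')
    rcases LinearMap.bijective_or_eq_zero χ with h | h
    · exact absurd (similar_of_equiv (LinearEquiv.ofBijective (toLin χ) h)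
        (fun j v => toLin_intertwine χ j v)) (hns r r' n n' B B' hB hB' a a')
    · exact LinearMap.congr_fun h x
  ext w
  have := LinearMap.congr_fun hψ (e w)
  simpa [ψ] using this

/-- The matrix of an endomorphism of the module of a point. -/
noncomputable def endMatrix {s : ℕ} {Y : Point k g s}
    (φ : PtMod Y →ₗ[FreeAlgebra k (Fin g)] PtMod Y) : Matrix (Fin s) (Fin s) k :=
  LinearMap.toMatrix' (toLin φ)

lemma endMatrix_mulVec {s : ℕ} {Y : Point k g s}
    (φ : PtMod Y →ₗ[FreeAlgebra k (Fin g)] PtMod Y) (v : Fin s → k) :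
    toMod (pointOp Y) ((endMatrix φ).mulVec v) = φ (toMod _ v) := by
  rw [← toMod_toLin, endMatrix, LinearMap.toMatrix'_mulVec]

lemma endMatrix_comm {s : ℕ} {Y : Point k g s}
    (φ : PtMod Y →ₗ[FreeAlgebra k (Fin g)] PtMod Y) (j : Fin g) :
    endMatrix φ * Y j = Y j * endMatrix φ := by
  refine Matrix.toLin'.injective (LinearMap.ext fun v => ?_)
  simpa [endMatrix, Matrix.toLin'_mul] using toLin_intertwine φ j v

end Modules

end FreeNC
namespace FreeNC

/-! ### Block triangular extensions of tuples -/

section Extension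

variable {k : Type*} [Field k] {g : ℕ}
  {W W' : Type*} [AddCommGroup W] [Module k W] [AddCommGroup W'] [Module k W']

/-- The block upper triangular tuple `(X, Z; 0, X')`. -/
def extOp (X : Fin g → Module.End k W) (Z : Fin g → W' →ₗ[k] W) (X' : Fin g → Module.End k W')
    (j : Fin g) : Module.End k (W × W') :=
  (X j ∘ₗ LinearMap.fst k W W' + Z j ∘ₗ LinearMap.snd k W W').prod (X' j ∘ₗ LinearMap.snd k W W')

@[simp] lemma extOp_apply (X : Fin g → Module.End k W) (Z : Fin g → W' →ₗ[k] W)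
    (X' : Fin g → Module.End k W') (j : Fin g) (w : W × W') :
    extOp X Z X' j w = (X j w.1 + Z j w.2, X' j w.2) := rfl

end Extension

/-! ### Splitting first order deformations of a semisimple point -/

section Splitting

open NCMod

variable {k : Type*} [Field k] {g s : ℕ} {ι : Type*}

lemma smul_pi_toMod {Y : Point k g s} (p : FreeAlgebra k (Fin g)) (w : ι → Fin s → k) :
    p • (fun i => toMod (pointOp Y) (w i))
      = fun i => toMod (pointOp Y) ((evalPoly p s Y).mulVec (w i)) := by
  funext i
  rw [Pi.smul_apply, smul_toMod, evalPoly_mulVec]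

/-- The matrix entries of an endomorphism of a power of the module of a point. -/
noncomputable def entry [DecidableEq ι] {Y : Point k g s}
    (π : (ι → PtMod Y) →ₗ[FreeAlgebra k (Fin g)] (ι → PtMod Y)) (l i : ι) :
    Matrix (Fin s) (Fin s) k :=
  endMatrix (LinearMap.proj l ∘ₗ π ∘ₗ LinearMap.single (FreeAlgebra k (Fin g)) (fun _ => PtMod Y) i)

lemma entry_mulVec [DecidableEq ι] {Y : Point k g s}
    (π : (ι → PtMod Y) →ₗ[FreeAlgebra k (Fin g)] (ι → PtMod Y)) (l i : ι) (v : Fin s → k) :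
    toMod (pointOp Y) ((entry π l i).mulVec v)
      = π (Pi.single i (toMod (pointOp Y) v)) l := by
  rw [entry, endMatrix_mulVec]
  rfl

lemma sum_entry_mulVec [Fintype ι] [DecidableEq ι] {Y : Point k g s}
    (π : (ι → PtMod Y) →ₗ[FreeAlgebra k (Fin g)] (ι → PtMod Y)) (w : ι → Fin s → k) (l : ι) :
    toMod (pointOp Y) (∑ i, (entry π l i).mulVec (w i))
      = π (fun i => toMod (pointOp Y) (w i)) l := by
  rw [map_sum]
  simp only [entry_mulVec]
  rw [← Finset.sum_apply, ← map_sum, Finset.univ_sum_single]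

lemma exists_projection {A M : Type*} [Ring A] [AddCommGroup M] [Module A M]
    [IsSemisimpleModule A M] (W : Submodule A M) :
    ∃ π : M →ₗ[A] W, ∀ w : W, π w = w := by
  obtain ⟨π, h⟩ := IsSemisimpleModule.extension_property W.subtype W.injective_subtype LinearMap.id
  exact ⟨π, fun w => LinearMap.congr_fun h w⟩

lemma exists_linearMap_comp_eq {A M N P : Type*} [Ring A] [AddCommGroup M] [Module A M]
    [AddCommGroup N] [Module A N] [AddCommGroup P] [Module A P] (f : M →ₗ[A] N) (h : M →ₗ[A] P)
    (hk : LinearMap.ker f ≤ LinearMap.ker h) :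
    ∃ ψ : LinearMap.range f →ₗ[A] P, ∀ x, ψ (f.rangeRestrict x) = h x := by
  refine ⟨(LinearMap.ker f).liftQ h hk ∘ₗ f.quotKerEquivRange.symm.toLinearMap, fun x => ?_⟩
  have : f.quotKerEquivRange.symm (f.rangeRestrict x) = (LinearMap.ker f).mkQ x := by
    rw [LinearEquiv.symm_apply_eq]
    rfl
  simp [this]

/-- A modulo the vanishing ideal of `Y` embeds into a power of the semisimple module of `Y`, through
the values on the standard basis. Every cyclic submodule of `N` is a quotient of it, and `N` is the
sum of these. -/
lemma isSemisimpleModule_of_forall_smul_eq_zero (Y : Point k g s)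
    [IsSemisimpleModule (FreeAlgebra k (Fin g)) (PtMod Y)] {N : Type*} [AddCommGroup N]
    [Module (FreeAlgebra k (Fin g)) N] (hN : ∀ p, evalPoly p s Y = 0 → ∀ x : N, p • x = 0) :
    IsSemisimpleModule (FreeAlgebra k (Fin g)) N := by
  let e : Fin s → PtMod Y := fun i => toMod (pointOp Y) (Pi.single i 1)
  let φ := LinearMap.toSpanSingleton (FreeAlgebra k (Fin g)) (Fin s → PtMod Y) e
  have hφ : ∀ p, φ p = 0 → evalPoly p s Y = 0 := by
    intro p hp
    refine Matrix.ext_of_mulVec_single fun i => ?_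
    have := congrFun ((smul_pi_toMod (Y := Y) p fun i : Fin s => Pi.single i (1 : k)).symm.trans hp) i
    rw [Matrix.zero_mulVec]
    exact this
  have hψ : ∀ x : N, ∃ ψ : LinearMap.range φ →ₗ[FreeAlgebra k (Fin g)] N,
      ∀ p, ψ (φ.rangeRestrict p) = p • x := by
    intro x
    obtain ⟨ψ, h⟩ := exists_linearMap_comp_eq φ
      (LinearMap.toSpanSingleton (FreeAlgebra k (Fin g)) N x)
      (fun p hp => by simpa using hN p (hφ p hp) x)
    exact ⟨ψ, fun p => by simpa using h p⟩
  choose ψ hψ using hψ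
  refine isSemisimpleModule_of_isSemisimpleModule_submodule' (p := fun x => LinearMap.range (ψ x))
    (fun x => .range _) ?_
  rw [eq_top_iff]
  intro x _
  refine Submodule.mem_iSup_of_mem x ⟨φ.rangeRestrict 1, ?_⟩
  rw [hψ, one_smul]

/-- The tuple of the first order deformation of a power of a point. -/
def deform [Fintype ι] (Y : Point k g s) (Z : ι → Point k g s) :
    Fin g → Module.End k ((Fin s → k) × (ι → Fin s → k)) :=
  extOp (pointOp Y) (fun j => ∑ i, (Z i j).mulVecLin ∘ₗ LinearMap.proj i)
    (fun j => LinearMap.pi fun i => (Y j).mulVecLin ∘ₗ LinearMap.proj i)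

lemma act_deform [Fintype ι] (Y : Point k g s) (Z : ι → Point k g s) (p : FreeAlgebra k (Fin g))
    (w : (Fin s → k) × (ι → Fin s → k)) :
    act (deform Y Z) p w
      = ((evalPoly p s Y).mulVec w.1 + ∑ i, (derivAt Y p (Z i)).mulVec (w.2 i),
          fun i => (evalPoly p s Y).mulVec (w.2 i)) := by
  induction p generalizing w with
  | grade0 c =>
    simp only [derivAt_algebraMap, Matrix.zero_mulVec, Finset.sum_const_zero]
    ext <;> simp [evalPoly, Algebra.algebraMap_eq_smul_one, Matrix.smul_mulVec]
  | grade1 j =>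
    ext <;> simp [deform, derivAt_ι, evalPoly]
  | mul p q hp hq =>
    rw [act_mul, hq, hp]
    have he : evalPoly (p * q) s Y = evalPoly p s Y * evalPoly q s Y := by simp [evalPoly]
    simp only [derivAt_mul, he, Matrix.mulVec_add, Matrix.mulVec_mulVec, Matrix.add_mulVec,
      Finset.sum_add_distrib, Matrix.mulVec_sum, add_assoc]
  | add p q hp hq =>
    have he : evalPoly (p + q) s Y = evalPoly p s Y + evalPoly q s Y := by simp [evalPoly]
    rw [act_add, LinearMap.add_apply, hp, hq]
    simp only [derivAt_add, he, Matrix.add_mulVec, Finset.sum_add_distrib, Prod.mk_add_mk]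
    congr 1
    abel

/-- The vectors (0, θ) generate a submodule `N` of the deformation along `Z`. By `hΘ` it is
annihilated by the vanishing ideal of `Y`, hence semisimple, so its projection to the power of `Y`
has a section on its image. Composed with a projection onto that image, the section is an
intertwiner with components τ and P. -/
lemma exists_balanced_of_deriv_eq_zero [Fintype ι] [DecidableEq ι] (Y : Point k g s)
    [IsSemisimpleModule (FreeAlgebra k (Fin g)) (PtMod Y)] (Z : ι → Point k g s)
    (Θ : Set (ι → Fin s → k))
    (hΘ : ∀ p, evalPoly p s Y = 0 → ∀ θ ∈ Θ, ∑ i, (derivAt Y p (Z i)).mulVec (θ i) = 0) :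
    ∃ (P : ι → ι → Matrix (Fin s) (Fin s) k) (τ : ι → Matrix (Fin s) (Fin s) k),
      (∀ l i j, P l i * Y j = Y j * P l i) ∧
      (∀ θ ∈ Θ, ∀ l, ∑ i, (P l i).mulVec (θ i) = θ l) ∧
      ∀ i, ∑ l, rmul (Z l) (P l i) = bracket (τ i) Y := by
  let E := NCMod (deform Y Z)
  let N : Submodule (FreeAlgebra k (Fin g)) E :=
    Submodule.span _ ((fun θ => toMod (deform Y Z) (0, θ)) '' Θ)
  have hN : ∀ p, evalPoly p s Y = 0 → ∀ x : N, p • x = 0 := by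
    rintro p hp ⟨x, hx⟩
    refine Subtype.ext ?_
    change p • x = 0
    induction hx using Submodule.span_induction generalizing p with
    | mem x hx =>
      obtain ⟨θ, hθ, rfl⟩ := hx
      rw [smul_toMod, act_deform]
      simp [hp, hΘ p hp θ hθ]
      rfl
    | zero => simp
    | add x y _ _ hx hy => rw [smul_add, hx p hp, hy p hp, add_zero]
    -- The vanishing ideal is two-sided, so p * a vanishes at `Y` again; this is why `p` is
    -- generalized.
    | smul a x _ hx =>
      rw [← mul_smul]
      exact hx _ (by simp_all [evalPoly])
  have := isSemisimpleModule_of_forall_smul_eq_zero (N := N) Y hN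
  let pr : E →ₗ[FreeAlgebra k (Fin g)] (ι → PtMod Y) :=
    { toFun := fun x i => toMod (pointOp Y) (((toMod (deform Y Z)).symm x).2 i)
      map_add' := fun x y => rfl
      map_smul' := fun p x => by
        rw [RingHom.id_apply, smul_pi_toMod, smul_def, LinearEquiv.symm_apply_apply, act_deform] }
  let f := pr ∘ₗ N.subtype
  obtain ⟨σ, hσ⟩ := IsSemisimpleModule.lifting_property f.rangeRestrict
    f.surjective_rangeRestrict LinearMap.id
  obtain ⟨π, hπ⟩ := exists_projection (LinearMap.range f)
  let π' := (LinearMap.range f).subtype ∘ₗ π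
  let σ' : (ι → PtMod Y) →ₗ[FreeAlgebra k (Fin g)] E := N.subtype ∘ₗ σ ∘ₗ π
  have hsnd : ∀ w, pr (σ' w) = π' w := by
    intro w
    have := LinearMap.congr_fun hσ (π w)
    exact congrArg Subtype.val this
  let U : ι → PtMod Y →ₗ[k] E := fun i => (σ' ∘ₗ LinearMap.single (FreeAlgebra k (Fin g))
    (fun _ => PtMod Y) i).restrictScalars k
  let T : ι → (Fin s → k) →ₗ[k] (Fin s → k) := fun i =>
    LinearMap.fst k _ _ ∘ₗ (toMod (deform Y Z)).symm.toLinearMap ∘ₗ U i ∘ₗ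
      (toMod (pointOp Y)).toLinearMap
  refine ⟨entry π', fun i => LinearMap.toMatrix' (T i), fun l i j => endMatrix_comm _ j,
    fun θ hθ l => ?_, fun i => ?_⟩
  · apply (toMod (pointOp Y)).injective
    rw [sum_entry_mulVec]
    have hmem : (fun i => toMod (pointOp Y) (θ i)) ∈ LinearMap.range f :=
      ⟨⟨toMod (deform Y Z) (0, θ), Submodule.subset_span ⟨θ, hθ, rfl⟩⟩, rfl⟩
    exact congrFun (congrArg Subtype.val (hπ ⟨_, hmem⟩)) l
  · funext j
    refine Matrix.toLin'.injective (LinearMap.ext fun v => ?_)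
    have hval : ∀ v : Fin s → k, (toMod (deform Y Z)).symm
        (σ' (Pi.single i (toMod (pointOp Y) v))) = (T i v, fun l => (entry π' l i).mulVec v) := by
      intro v
      refine Prod.ext rfl (funext fun l => ?_)
      apply (toMod (pointOp Y)).injective
      rw [entry_mulVec, ← hsnd]
      rfl
    -- The first component of linearity in x_j reads τ_i Y_j = Y_j τ_i + Σ_l Z_l,j P_li.
    have h1 := σ'.map_smul (FreeAlgebra.ι k j) (Pi.single i (toMod (pointOp Y) v))
    rw [← Pi.single_smul, smul_toMod, act_ι, smul_def, act_ι, pointOp_apply] at h1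
    have h2 := congrArg (toMod (deform Y Z)).symm h1
    rw [hval, LinearEquiv.symm_apply_apply, hval] at h2
    have h3 := congrArg Prod.fst h2
    simp only [deform, extOp_apply, pointOp_apply, LinearMap.sum_apply, LinearMap.comp_apply,
      LinearMap.proj_apply, Matrix.mulVecLin_apply] at h3
    simp only [bracket, Finset.sum_apply, rmul, map_sum, map_sub, LinearMap.sub_apply,
      LinearMap.sum_apply, Matrix.toLin'_mul, LinearMap.comp_apply, Matrix.toLin'_toMatrix',
      Matrix.toLin'_apply, h3]
    abel

end Splitting

end FreeNC
namespace FreeNC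

/-! ### Interpolation at one semisimple point -/

section OnePoint

open NCMod

universe u

variable {k : Type u} [Field k] {g s : ℕ}

/-- The polynomials vanishing at a point. -/
abbrev Vanishing (Y : Point k g s) : Type _ := {p : FreeAlgebra k (Fin g) // evalPoly p s Y = 0}

/-- The product of the first order differentials of `m` polynomials. -/
noncomputable def prodDeriv (Y : Point k g s) : ∀ m : ℕ, (Fin m → Vanishing Y) →
    (Fin m → Point k g s) → Matrix (Fin s) (Fin s) k
  | 0, _, _ => 1
  | m + 1, q, Z => derivAt Y (q 0).1 (Z 0) * prodDeriv Y m (Fin.tail q) (Fin.tail Z)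

/-- The product of `m` polynomials. -/
def prodPoly (Y : Point k g s) : ∀ m : ℕ, (Fin m → Vanishing Y) → FreeAlgebra k (Fin g)
  | 0, _ => 1
  | m + 1, q => (q 0).1 * prodPoly Y m (Fin.tail q)

lemma polyDiff_mul (Y : Point k g s) (p q : FreeAlgebra k (Fin g)) :
    polyDiff Y (p * q) = act (varMul Y) p (polyDiff Y q) := by
  simp [polyDiff]

/-- Each factor vanishing at `Y` raises the order by one and contributes its derivative on the left.
-/
lemma polyDiff_prodPoly (Y : Point k g s) (m : ℕ) (q : Fin m → Vanishing Y) :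
    (∀ ℓ < m, polyDiff Y (prodPoly Y m q) ℓ = 0) ∧
      ∀ Z, polyDiff Y (prodPoly Y m q) m Z = prodDeriv Y m q Z := by
  induction m with
  | zero => exact ⟨by simp, fun Z => by simp [prodPoly, prodDeriv, polyDiff]⟩
  | succ m ih =>
    obtain ⟨h1, h2⟩ := ih (Fin.tail q)
    obtain ⟨l1, l2, l3⟩ := act_varMul_leading Y (q 0).1 m _ h1
    rw [prodPoly, polyDiff_mul]
    refine ⟨fun ℓ hℓ => ?_, fun Z => ?_⟩
    · rcases Nat.lt_succ_iff_lt_or_eq.mp hℓ with h | rfl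
      · exact l1 ℓ h
      · exact MultilinearMap.ext fun Z => by rw [l2, (q 0).2, zero_mul]; rfl
    · rw [l3, (q 0).2, zero_mul, zero_add, h2, prodDeriv]

lemma prodDeriv_lmul {Y : Point k g s} {S : Matrix (Fin s) (Fin s) k}
    (hS : ∀ j, S * Y j = Y j * S) {m : ℕ} (q : Fin (m + 1) → Vanishing Y)
    (Z : Fin (m + 1) → Point k g s) :
    prodDeriv Y (m + 1) q (Function.update Z 0 (lmul S (Z 0))) = S * prodDeriv Y (m + 1) q Z := by
  rw [prodDeriv, prodDeriv, Function.update_self, derivAt_lmul hS, Fin.tail_update_zero, mul_assoc]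

/-- The value of the products of `m` differentials on a tuple of points and a vector. -/
noncomputable def evalDeriv (Y : Point k g s) {m : ℕ} (Z : Fin m → Point k g s) (η : Fin s → k)
    (q : Fin m → Vanishing Y) : Fin s → k :=
  (prodDeriv Y m q Z).mulVec η

/-- Pointwise multiplication by a matrix. -/
def mulVecPi (Q : Type*) (S : Matrix (Fin s) (Fin s) k) : (Q → Fin s → k) →ₗ[k] (Q → Fin s → k) :=
  LinearMap.pi fun q => S.mulVecLin ∘ₗ LinearMap.proj q

@[simp] lemma mulVecPi_apply (Q : Type*) (S : Matrix (Fin s) (Fin s) k) (θ : Q → Fin s → k)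
    (q : Q) : mulVecPi Q S θ q = S.mulVec (θ q) := rfl

lemma mulVecPi_evalDeriv_zero (Y : Point k g s) (S : Matrix (Fin s) (Fin s) k)
    (Z : Fin 0 → Point k g s) (η : Fin s → k) :
    mulVecPi _ S (evalDeriv Y Z η) = evalDeriv Y Z (S.mulVec η) := by
  funext q
  simp [evalDeriv, prodDeriv]

lemma mulVecPi_evalDeriv_succ {Y : Point k g s} {S : Matrix (Fin s) (Fin s) k}
    (hS : ∀ j, S * Y j = Y j * S) {m : ℕ} (Z : Fin (m + 1) → Point k g s) (η : Fin s → k) :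
    mulVecPi _ S (evalDeriv Y Z η) = evalDeriv Y (Function.update Z 0 (lmul S (Z 0))) η := by
  funext q
  simp [evalDeriv, prodDeriv_lmul hS]

/-- Multilinear maps that vanish on brackets with `Y` and are balanced over the centralizer
of `Y`. -/
structure IsBalanced (Y : Point k g s) {m : ℕ} {H : Type*} [AddCommGroup H] [Module k H]
    (G : MultilinearMap k (fun _ : Fin m => Point k g s) ((Fin s → k) →ₗ[k] H)) : Prop where
  map_bracket : ∀ Z i S, Z i = bracket S Y → G Z = 0
  mid : ∀ i j : Fin m, i.val + 1 = j.val → ∀ S, (∀ j, S * Y j = Y j * S) → ∀ Z,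
    G (Function.update Z i (rmul (Z i) S)) = G (Function.update Z j (lmul S (Z j)))
  last : ∀ i : Fin m, i.val + 1 = m → ∀ S, (∀ j, S * Y j = Y j * S) → ∀ Z η,
    G (Function.update Z i (rmul (Z i) S)) η = G Z (S.mulVec η)

/-- Currying the first argument of a multilinear map into the target. -/
noncomputable def flipCurry {m : ℕ} {H : Type*} [AddCommGroup H] [Module k H]
    (G : MultilinearMap k (fun _ : Fin (m + 1) => Point k g s) ((Fin s → k) →ₗ[k] H)) :
    MultilinearMap k (fun _ : Fin m => Point k g s)
      ((Fin s → k) →ₗ[k] (Point k g s →ₗ[k] H)) :=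
  MultilinearMap.mk' (fun Z' => LinearMap.flip
    { toFun := fun z => G.curryLeft z Z'
      map_add' := fun z z' => by simp
      map_smul' := fun c z => by simp })
    (fun Z' i x y => by ext; simp)
    (fun Z' i c x => by ext; simp)

@[simp] lemma flipCurry_apply {m : ℕ} {H : Type*} [AddCommGroup H] [Module k H]
    (G : MultilinearMap k (fun _ : Fin (m + 1) => Point k g s) ((Fin s → k) →ₗ[k] H))
    (Z' : Fin m → Point k g s) (η : Fin s → k) (z : Point k g s) :
    flipCurry G Z' η z = G (Fin.cons z Z') η := rfl

lemma IsBalanced.flipCurry {Y : Point k g s} {m : ℕ} {H : Type*} [AddCommGroup H] [Module k H]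
    {G : MultilinearMap k (fun _ : Fin (m + 1) => Point k g s) ((Fin s → k) →ₗ[k] H)}
    (hG : IsBalanced Y G) : IsBalanced Y (flipCurry G) where
  map_bracket Z i S h := by
    refine LinearMap.ext fun η => LinearMap.ext fun z => ?_
    rw [flipCurry_apply, hG.map_bracket _ i.succ S (by simpa using h)]
    rfl
  mid i j hij S hS Z := by
    refine LinearMap.ext fun η => LinearMap.ext fun z => ?_
    have := hG.mid i.succ j.succ (by simpa using hij) S hS (Fin.cons z Z)
    rw [flipCurry_apply, flipCurry_apply, Fin.cons_update, Fin.cons_update]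
    simpa using LinearMap.congr_fun this η
  last i hi S hS Z η := by
    refine LinearMap.ext fun z => ?_
    have := hG.last i.succ (by simpa using hi) S hS (Fin.cons z Z) η
    rw [flipCurry_apply, flipCurry_apply, Fin.cons_update]
    simpa using this

/-- Moves `S` across the gap behind the curried argument. The neighbour is `η` when m = 0 and the
next point otherwise, whence the fields `last` and `mid`. -/
lemma IsBalanced.cons_rmul {Y : Point k g s} {m : ℕ} {H : Type*} [AddCommGroup H] [Module k H]
    {G : MultilinearMap k (fun _ : Fin (m + 1) => Point k g s) ((Fin s → k) →ₗ[k] H)}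
    (hG : IsBalanced Y G) (δ : ((Fin m → Vanishing Y) → Fin s → k) →ₗ[k] (Point k g s →ₗ[k] H))
    (hδ : ∀ Z η, FreeNC.flipCurry G Z η = δ (evalDeriv Y Z η)) {S : Matrix (Fin s) (Fin s) k}
    (hS : ∀ j, S * Y j = Y j * S) (Z : Fin m → Point k g s) (η : Fin s → k) (z : Point k g s) :
    δ (mulVecPi _ S (evalDeriv Y Z η)) z = δ (evalDeriv Y Z η) (rmul z S) := by
  cases m with
  | zero =>
    rw [mulVecPi_evalDeriv_zero, ← hδ, ← hδ, flipCurry_apply, flipCurry_apply,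
      ← hG.last 0 rfl S hS, Fin.cons_zero, Fin.update_cons_zero]
  | succ m =>
    have := hG.mid 0 1 rfl S hS (Fin.cons z Z)
    rw [Fin.cons_zero, Fin.update_cons_zero, show (1 : Fin (m + 1 + 1)) = Fin.succ 0 from rfl,
      ← Fin.cons_update, Fin.cons_succ] at this
    rw [mulVecPi_evalDeriv_succ hS, ← hδ, ← hδ, flipCurry_apply, flipCurry_apply, this]

/-- It suffices that each linear relation among the vectors `evalDeriv Y Z η` also holds among the
values of `G`. Induction on `m` by currying the first argument: the tails are controlled by δ, and
the first arguments by `exists_balanced_of_deriv_eq_zero`. -/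
theorem IsBalanced.exists_factor (Y : Point k g s)
    [IsSemisimpleModule (FreeAlgebra k (Fin g)) (PtMod Y)] {m : ℕ} {H : Type u} [AddCommGroup H]
    [Module k H] {G : MultilinearMap k (fun _ : Fin m => Point k g s) ((Fin s → k) →ₗ[k] H)}
    (hG : IsBalanced Y G) :
    ∃ δ : ((Fin m → Vanishing Y) → Fin s → k) →ₗ[k] H, ∀ Z η, G Z η = δ (evalDeriv Y Z η) := by
  classical
  induction m generalizing H with
  | zero =>
    refine ⟨G Fin.elim0 ∘ₗ LinearMap.proj Fin.elim0, fun Z η => ?_⟩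
    obtain rfl : Z = Fin.elim0 := Subsingleton.elim _ _
    simp [evalDeriv, prodDeriv]
  | succ m ih =>
    obtain ⟨δ, hδ⟩ := ih hG.flipCurry
    let α := Finsupp.linearCombination k
      (fun x : (Fin (m + 1) → Point k g s) × (Fin s → k) => evalDeriv Y x.1 x.2)
    let β := Finsupp.linearCombination k
      (fun x : (Fin (m + 1) → Point k g s) × (Fin s → k) => G x.1 x.2)
    have hker : LinearMap.ker α ≤ LinearMap.ker β := by
      intro c hc
      rw [LinearMap.mem_ker] at hc ⊢
      let θ : c.support → (Fin m → Vanishing Y) → Fin s → k :=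
        fun x => evalDeriv Y (Fin.tail x.1.1) x.1.2
      have hc' : ∀ q, ∑ x : c.support, c x.1 • evalDeriv Y x.1.1 x.1.2 q = 0 := by
        intro q
        have := congrFun hc q
        simp only [α, Finsupp.linearCombination_apply, Finsupp.sum, Finset.sum_apply,
          Pi.smul_apply, Pi.zero_apply] at this
        rw [← this]
        exact Finset.sum_coe_sort c.support fun x => c x • evalDeriv Y x.1 x.2 q
      -- The coefficients are absorbed into the first arguments. Reading the relation at the tuple
      -- (p, q) gives the required vanishing for the vector of tails at q.
      obtain ⟨P, τ, hP, hfix, hbr⟩ := exists_balanced_of_deriv_eq_zero Y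
        (fun x : c.support => c x.1 • x.1.1 0) (Set.range fun q x => θ x q) (by
          rintro p hp _ ⟨q, rfl⟩
          rw [← hc' (Fin.cons ⟨p, hp⟩ q)]
          refine Finset.sum_congr rfl fun x _ => ?_
          simp [evalDeriv, prodDeriv, θ, Matrix.smul_mulVec])
      have hθ : ∀ l, θ l = ∑ i, mulVecPi _ (P l i) (θ i) := by
        intro l
        funext q
        rw [Finset.sum_apply]
        exact (hfix _ ⟨q, rfl⟩ l).symm
      have hval : ∀ x : c.support, G x.1.1 x.1.2 = δ (θ x) (x.1.1 0) := by
        intro x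
        rw [← hδ, flipCurry_apply, Fin.cons_self_tail]
      calc β c = ∑ x : c.support, δ (θ x) (c x.1 • x.1.1 0) := by
            simp only [β, Finsupp.linearCombination_apply, Finsupp.sum, map_smul, ← hval]
            rw [← Finset.sum_coe_sort]
        _ = ∑ x : c.support, ∑ i, δ (θ i) (rmul (c x.1 • x.1.1 0) (P x i)) := by
            refine Finset.sum_congr rfl fun x _ => ?_
            conv_lhs => rw [hθ x]
            rw [map_sum, LinearMap.sum_apply]
            exact Finset.sum_congr rfl fun i _ => hG.cons_rmul δ hδ (hP x i) _ _ _
        _ = ∑ i, δ (θ i) (bracket (τ i) Y) := by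
            rw [Finset.sum_comm]
            refine Finset.sum_congr rfl fun i _ => ?_
            rw [← hbr, map_sum]
        _ = 0 := by
            refine Finset.sum_eq_zero fun i _ => ?_
            rw [← hδ, flipCurry_apply, hG.map_bracket _ 0 (τ i) rfl]
            rfl
    obtain ⟨ψ, hψ⟩ := exists_linearMap_comp_eq α β hker
    -- ψ lives only on the span of the vectors `evalDeriv Y Z η`; any linear extension will do.
    obtain ⟨δ', hδ'⟩ := LinearMap.exists_extend ψ
    refine ⟨δ', fun Z η => ?_⟩
    have h1 := hψ (Finsupp.single (Z, η) 1)
    have h2 := LinearMap.congr_fun hδ' (α.rangeRestrict (Finsupp.single (Z, η) 1))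
    rw [h1] at h2
    simpa [α, β] using h2.symm

/-- Double centralizer argument: `W` is the image of a projection with entries in the centralizer of
`Y`, and δ commutes with the centralizer on the relevant vectors. So the values of `G` form a vector
fixed by the projection, which therefore lies in the A-span of the products. -/
theorem exists_polyDiff_eq_of_gap_eq (Y : Point k g s)
    [IsSemisimpleModule (FreeAlgebra k (Fin g)) (PtMod Y)] {L : ℕ} (G : MultiMap k g s L)
    (hbr : ∀ Z i S, Z i = bracket S Y → G Z = 0)
    (hgap : ∀ (t : Fin (L + 1)) S, (∀ j, S * Y j = Y j * S) → ∀ Z,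
      gapLeft G t S Z = gapRight G t S Z) :
    ∃ p, (∀ ℓ < L, polyDiff Y p ℓ = 0) ∧ polyDiff Y p L = G := by
  classical
  let G' : MultilinearMap k (fun _ : Fin L => Point k g s) ((Fin s → k) →ₗ[k] (Fin s → k)) :=
    (Matrix.toLin' (R := k) (m := Fin s) (n := Fin s)).toLinearMap.compMultilinearMap G
  have hG'apply : ∀ Z η, G' Z η = (G Z).mulVec η := fun Z η => rfl
  have hG' : IsBalanced Y G' :=
    { map_bracket := fun Z i S h => by simp [G', hbr Z i S h]
      mid := fun i j hij S hS Z => by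
        have h := hgap i.succ S hS Z
        rw [gapLeft_succ, show i.succ = j.castSucc from Fin.ext (by simpa using hij),
          gapRight_castSucc] at h
        simp only [G', LinearMap.compMultilinearMap_apply, h]
      last := fun i hi S hS Z η => by
        have h := hgap i.succ S hS Z
        rw [gapLeft_succ, show i.succ = Fin.last L from Fin.ext (by simpa using hi),
          gapRight_last] at h
        rw [hG'apply, hG'apply, h, Matrix.mulVec_mulVec] }
  obtain ⟨δ, hδ⟩ := hG'.exists_factor Y
  have hδS : ∀ S, (∀ j, S * Y j = Y j * S) → ∀ Z η,
      δ (mulVecPi _ S (evalDeriv Y Z η)) = S.mulVec (δ (evalDeriv Y Z η)) := by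
    intro S hS Z η
    have h := hgap 0 S hS Z
    cases L with
    | zero =>
      rw [gapLeft_zero, show (0 : Fin (0 + 1)) = Fin.last 0 from rfl, gapRight_last] at h
      rw [mulVecPi_evalDeriv_zero, ← hδ, ← hδ, hG'apply, hG'apply, Matrix.mulVec_mulVec,
        Matrix.mulVec_mulVec, h]
    | succ L =>
      rw [gapLeft_zero, show (0 : Fin (L + 1 + 1)) = Fin.castSucc 0 from rfl,
        gapRight_castSucc] at h
      rw [mulVecPi_evalDeriv_succ hS, ← hδ, ← hδ, hG'apply, hG'apply, Matrix.mulVec_mulVec, h]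
  let b := Module.finBasis k (Point k g s)
  -- Basis arguments determine `G` and keep the index set finite, as is needed to expand the
  -- projection in matrix entries.
  let ι := (Fin L → Fin (Module.finrank k (Point k g s))) × Fin s
  let θ : ι → (Fin L → Vanishing Y) → Fin s → k :=
    fun i => evalDeriv Y (fun t => b (i.1 t)) (Pi.single i.2 1)
  let W : Submodule (FreeAlgebra k (Fin g)) (ι → PtMod Y) :=
    Submodule.span _ (Set.range fun q i => toMod (pointOp Y) (θ i q))
  obtain ⟨π, hπ⟩ := exists_projection W
  let π' := W.subtype ∘ₗ π
  have hθ : ∀ l, θ l = ∑ i, mulVecPi _ (entry π' l i) (θ i) := by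
    intro l
    funext q
    rw [Finset.sum_apply]
    apply (toMod (pointOp Y)).injective
    refine Eq.trans ?_ (sum_entry_mulVec π' (fun i => θ i q) l).symm
    exact (congrFun (congrArg Subtype.val (hπ ⟨_, Submodule.subset_span ⟨q, rfl⟩⟩)) l).symm
  have hmem : (fun l => toMod (pointOp Y) (δ (θ l))) ∈ W := by
    have : (fun l => toMod (pointOp Y) (δ (θ l)))
        = π' (fun l => toMod (pointOp Y) (δ (θ l))) := by
      funext l
      rw [← sum_entry_mulVec]
      conv_lhs => rw [hθ l]
      rw [map_sum]
      congr 1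
      exact Finset.sum_congr rfl fun i _ => hδS _ (fun j => endMatrix_comm _ j) _ _
    rw [this]
    exact (π _).2
  obtain ⟨c, hc⟩ := Finsupp.mem_span_range_iff_exists_finsupp.mp hmem
  have hlead := fun q => act_varMul_leading Y (c q) L _ (polyDiff_prodPoly Y L q).1
  have hsum : polyDiff Y (∑ q ∈ c.support, c q * prodPoly Y L q)
      = ∑ q ∈ c.support, act (varMul Y) (c q) (polyDiff Y (prodPoly Y L q)) := by
    simp [polyDiff]
  refine ⟨∑ q ∈ c.support, c q * prodPoly Y L q, fun ℓ hℓ => ?_, ?_⟩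
  · rw [hsum, Finset.sum_apply]
    exact Finset.sum_eq_zero fun q _ => (hlead q).1 ℓ hℓ
  · refine Module.Basis.ext_multilinear (fun _ => b) fun v => ?_
    refine Matrix.ext_of_mulVec_single fun i => ?_
    have h1 : (G fun t => b (v t)).mulVec (Pi.single i 1) = δ (θ (v, i)) := (hδ _ _)
    have h2 := congrFun hc (v, i)
    rw [h1, hsum, Finset.sum_apply, sum_apply, Matrix.sum_mulVec]
    apply (toMod (pointOp Y)).injective
    rw [← h2, map_sum, Finsupp.sum, Finset.sum_apply]
    refine Finset.sum_congr rfl fun q _ => ?_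
    rw [(hlead q).2.1, (polyDiff_prodPoly Y L q).2, smul_pi_toMod, ← Matrix.mulVec_mulVec]
    rfl

lemma gapLeft_sub {m : ℕ} (f f' : MultiMap k g s m) (t : Fin (m + 1)) (S : Matrix (Fin s) (Fin s) k)
    (Z : Fin m → Point k g s) : gapLeft (f - f') t S Z = gapLeft f t S Z - gapLeft f' t S Z := by
  cases t using Fin.cases <;> simp [gapLeft_zero, gapLeft_succ, mul_sub]

lemma gapRight_sub {m : ℕ} (f f' : MultiMap k g s m) (t : Fin (m + 1))
    (S : Matrix (Fin s) (Fin s) k) (Z : Fin m → Point k g s) :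
    gapRight (f - f') t S Z = gapRight f t S Z - gapRight f' t S Z := by
  cases t using Fin.lastCases <;> simp [gapRight_last, gapRight_castSucc, sub_mul]

theorem exists_polyDiff_eq (Y : Point k g s)
    [IsSemisimpleModule (FreeAlgebra k (Fin g)) (PtMod Y)] {L : ℕ} {F : Seq k g s}
    (hF : TruncLAC Y L F) : ∃ p, ∀ ℓ ≤ L, polyDiff Y p ℓ = F ℓ := by
  induction L with
  | zero =>
    obtain ⟨p, -, hp⟩ := exists_polyDiff_eq_of_gap_eq Y (F 0) (fun _ i => i.elim0) hF.2
    exact ⟨p, fun ℓ hℓ => by obtain rfl := Nat.le_zero.mp hℓ; exact hp⟩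
  | succ L ih =>
    obtain ⟨h1, h2⟩ := hF
    obtain ⟨p, hp⟩ := ih ⟨fun m hm => h1 m (by omega), fun t S hS Z => by
      have h := h1 L (by omega) t S Z
      rw [show bracket S Y = 0 from funext fun j => by simp [bracket, hS],
        MultilinearMap.map_coord_zero _ t (by simp)] at h
      exact sub_eq_zero.mp h.symm⟩
    -- On brackets both terms are determined by their order L parts, which agree, so the difference
    -- vanishes there.
    obtain ⟨q, hq0, hq⟩ := exists_polyDiff_eq_of_gap_eq Y (F (L + 1) - polyDiff Y p (L + 1))
      (fun Z i S hZ => by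
        have e1 := h1 L (by omega) i S (i.removeNth Z)
        have e2 := lac_polyDiff Y p L i S (i.removeNth Z)
        rw [← hZ, Fin.insertNth_self_removeNth] at e1 e2
        rw [sub_apply, e1, e2, hp L le_rfl, sub_self])
      (fun t S hS Z => by
        rw [gapLeft_sub, gapRight_sub, h2 t S hS, (lac_polyDiff Y p).gap_eq hS])
    refine ⟨p + q, fun ℓ hℓ => ?_⟩
    have hadd : polyDiff Y (p + q) ℓ = polyDiff Y p ℓ + polyDiff Y q ℓ := by simp [polyDiff]
    rw [hadd]
    rcases Nat.le_succ_iff_eq_or_le.mp hℓ with rfl | h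
    · rw [hq, add_sub_cancel]
    · rw [hp ℓ h, hq0 ℓ (by omega), add_zero]

end OnePoint

end FreeNC
namespace FreeNC

/-! ### Gluing at separated points -/

section SeparatedPoints

open NCMod

variable {k : Type*} [Field k] {g : ℕ}

lemma act_pow_eq_zero {s : ℕ} {Y : Point k g s} {u : FreeAlgebra k (Fin g)}
    (hu : evalPoly u s Y = 0) (N : ℕ) (F : Seq k g s) :
    ∀ ℓ < N, act (varMul Y) (u ^ N) F ℓ = 0 := by
  induction N with
  | zero => simp
  | succ N ih =>
    obtain ⟨h1, h2, -⟩ := act_varMul_leading Y u N _ ih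
    intro ℓ hℓ
    rw [pow_succ', act_mul]
    rcases Nat.lt_succ_iff_lt_or_eq.mp hℓ with h | rfl
    · exact h1 ℓ h
    · exact MultilinearMap.ext fun Z => by rw [h2, hu, zero_mul]; rfl

lemma exists_one_sub_one_sub_pow {R : Type*} [Ring R] (y : R) (N : ℕ) :
    ∃ r, 1 - (1 - y) ^ N = y * r := by
  induction N with
  | zero => exact ⟨0, by simp⟩
  | succ N ih =>
    obtain ⟨r, hr⟩ := ih
    refine ⟨r + 1 - y * r, ?_⟩
    rw [pow_succ', ← sub_sub_cancel 1 ((1 - y) ^ N), hr]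
    noncomm_ring

/-- With no homomorphisms between different summands, every endomorphism of the direct sum is block
diagonal. The projection to the i-th summand thus lies in the bicommutant, and Jacobson density
realizes it on a finite basis. -/
lemma exists_evalPoly_eq_one {h : ℕ} {s : Fin h → ℕ} {Y : ∀ i, Point k g (s i)}
    [∀ i, IsSemisimpleModule (FreeAlgebra k (Fin g)) (PtMod (Y i))]
    (hom_zero : ∀ i i', i ≠ i' → ∀ φ : PtMod (Y i) →ₗ[FreeAlgebra k (Fin g)] PtMod (Y i'), φ = 0)
    (i : Fin h) :
    ∃ u, evalPoly u (s i) (Y i) = 1 ∧ ∀ i', i' ≠ i → evalPoly u (s i') (Y i') = 0 := by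
  classical
  let A := FreeAlgebra k (Fin g)
  let M := ∀ i, PtMod (Y i)
  have hcross : ∀ (φ : M →ₗ[A] M) (m : M) (i' : Fin h),
      φ m i' = φ (Pi.single i' (m i')) i' := by
    intro φ m i'
    conv_lhs => rw [← Finset.univ_sum_single m]
    rw [map_sum, Finset.sum_apply]
    refine Finset.sum_eq_single i' (fun j _ hj => ?_) (by simp)
    exact LinearMap.congr_fun (hom_zero j i' hj
      (LinearMap.proj i' ∘ₗ φ ∘ₗ LinearMap.single A (fun i => PtMod (Y i)) j)) (m j)
  let f : Module.End (Module.End A M) M :=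
    { toFun := fun m => Pi.single i (m i)
      map_add' := fun m m' => by rw [Pi.add_apply, Pi.single_add]
      map_smul' := fun φ m => by
        funext i'
        rw [RingHom.id_apply, Module.End.smul_def, Module.End.smul_def]
        by_cases hi : i' = i
        · subst hi
          rw [Pi.single_eq_same, hcross]
        · rw [Pi.single_eq_of_ne hi, hcross φ _ i', Pi.single_eq_of_ne hi, Pi.single_zero, map_zero]
          rfl }
  obtain ⟨u, hu⟩ := jacobson_density f (Finset.univ.image fun x : Σ i, Fin (s i) =>
    (Pi.single x.1 (toMod (pointOp (Y x.1)) (Pi.single x.2 1)) : M))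
  have hu' : ∀ (i' : Fin h) (b : Fin (s i')),
      toMod (pointOp (Y i')) ((evalPoly u (s i') (Y i')).mulVec (Pi.single b 1))
        = f (Pi.single i' (toMod (pointOp (Y i')) (Pi.single b 1))) i' := by
    intro i' b
    rw [hu _ (Finset.mem_image.mpr ⟨⟨i', b⟩, Finset.mem_univ _, rfl⟩), Pi.smul_apply,
      Pi.single_eq_same, smul_toMod, evalPoly_mulVec]
  refine ⟨u, ?_, fun i' hi' => ?_⟩
  · refine Matrix.ext_of_mulVec_single fun b => ?_
    have := hu' i b
    simp only [f, LinearMap.coe_mk, AddHom.coe_mk, Pi.single_eq_same] at this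
    rw [Matrix.one_mulVec]
    exact this
  · refine Matrix.ext_of_mulVec_single fun b => ?_
    have := hu' i' b
    simp only [f, LinearMap.coe_mk, AddHom.coe_mk, Pi.single_eq_of_ne hi'] at this
    rw [Matrix.zero_mulVec]
    exact this

theorem exists_polyDiff_eq_of_separated {h : ℕ} {s : Fin h → ℕ} {Y : ∀ i, Point k g (s i)}
    (hY : ∀ i, IsSemisimplePoint (Y i)) (hsep : Separated Y) (L : ℕ)
    (F : ∀ i, Seq k g (s i)) (hF : ∀ i, TruncLAC (Y i) L (F i)) :
    ∃ p, ∀ i, ∀ ℓ ≤ L, polyDiff (Y i) p ℓ = F i ℓ := by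
  classical
  have := fun i => (hY i).isSemisimpleModule
  choose p hp using fun i => exists_polyDiff_eq (Y i) (hF i)
  choose u hu1 hu0 using exists_evalPoly_eq_one (Y := Y) (fun i i' hi =>
    hom_eq_zero_of_not_similar (hY i) (hY i') (hsep i i' hi))
  -- With N = L + 1: 1 - u^N vanishes at Y^i, so its N-th power kills orders up to L there and e
  -- acts as the identity. At the other points e is a multiple of u^N and kills these orders.
  let e : Fin h → FreeAlgebra k (Fin g) := fun i => 1 - (1 - u i ^ (L + 1)) ^ (L + 1)
  have he1 : ∀ i, ∀ ℓ ≤ L, polyDiff (Y i) (e i * p i) ℓ = F i ℓ := by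
    intro i ℓ hℓ
    obtain ⟨r, hr⟩ := exists_one_sub_one_sub_pow (1 - u i) (L + 1)
    rw [sub_sub_cancel] at hr
    have hv : evalPoly (1 - u i ^ (L + 1)) (s i) (Y i) = 0 := by
      have h1 := hu1 i
      rw [hr]
      simp only [evalPoly, map_mul, map_sub, map_one] at h1 ⊢
      rw [h1, sub_self, zero_mul]
    rw [polyDiff_mul, act_sub, LinearMap.sub_apply, Pi.sub_apply,
      act_pow_eq_zero hv _ _ ℓ (by omega), sub_zero, act_one, Module.End.one_apply, hp i ℓ hℓ]
  have he0 : ∀ i j, i ≠ j → ∀ ℓ ≤ L, polyDiff (Y i) (e j * p j) ℓ = 0 := by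
    intro i j hij ℓ hℓ
    obtain ⟨r, hr⟩ := exists_one_sub_one_sub_pow (u j ^ (L + 1)) (L + 1)
    simp only [e]
    rw [hr, mul_assoc, polyDiff_mul]
    exact act_pow_eq_zero (hu0 j i hij) _ _ ℓ (by omega)
  refine ⟨∑ j, e j * p j, fun i ℓ hℓ => ?_⟩
  have hsum : polyDiff (Y i) (∑ j, e j * p j) = ∑ j, polyDiff (Y i) (e j * p j) := by
    simp only [polyDiff, act_sum, LinearMap.sum_apply]
  rw [hsum, Finset.sum_apply, Finset.sum_eq_single i, he1 i ℓ hℓ]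
  · exact fun j _ hj => he0 i j hj.symm ℓ hℓ
  · simp

end SeparatedPoints

end FreeNC
namespace FreeNC

/-! ### Values of an nc function, intertwiners and resolvable tuples -/

section Extensions

universe u

variable {k : Type u} [Field k] {g : ℕ} (Ω : ∀ n : ℕ, Set (Point k g n))
  (f : ∀ n : ℕ, Point k g n → Matrix (Fin n) (Fin n) k)

/-- `M` is the value at the tuple `X` of the nc function `f`, extended to all tuples that are
similar to a point of `Ω`. -/
def IsValue {W : Type*} [AddCommGroup W] [Module k W] (X : Fin g → Module.End k W)
    (M : Module.End k W) : Prop :=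
  ∃ (n : ℕ) (X₀ : Point k g n) (e : W ≃ₗ[k] (Fin n → k)), X₀ ∈ Ω n ∧
    (∀ j w, e (X j w) = (X₀ j).mulVec (e w)) ∧ ∀ w, e (M w) = (f n X₀).mulVec (e w)

variable {Ω f}

lemma isValue_pointOp {n : ℕ} {X : Point k g n} (hX : X ∈ Ω n) :
    IsValue Ω f (pointOp X) (f n X).mulVecLin :=
  ⟨n, X, LinearEquiv.refl k _, hX, fun _ _ => rfl, fun _ => rfl⟩

lemma fromBlocks_comm {m n : ℕ} {A A' : Matrix (Fin m) (Fin m) k} {B B' : Matrix (Fin n) (Fin n) k}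
    {S : Matrix (Fin m) (Fin n) k} :
    Matrix.reindex finSumFinEquiv finSumFinEquiv (Matrix.fromBlocks 1 S 0 1) * directSum A B
      = directSum A' B' * Matrix.reindex finSumFinEquiv finSumFinEquiv (Matrix.fromBlocks 1 S 0 1)
      ↔ A = A' ∧ S * B = A' * S ∧ B = B' := by
  simp only [directSum, Matrix.reindex_apply, Matrix.submatrix_mul_equiv, Matrix.fromBlocks_multiply]
  rw [← Matrix.reindex_apply, ← Matrix.reindex_apply, Equiv.apply_eq_iff_eq, Matrix.fromBlocks_inj]
  simp

/-- Conjugation by the unipotent matrix (1, S; 0, 1) fixes X ⊕ X' because `S` intertwines, so it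
also fixes f(X) ⊕ f(X'). -/
lemma IsNCFunction.intertwine (hΩ : IsNCSet Ω) (hf : IsNCFunction Ω f) {m n : ℕ}
    {X : Point k g m} {X' : Point k g n} (hX : X ∈ Ω m) (hX' : X' ∈ Ω n)
    (S : Matrix (Fin m) (Fin n) k) (hS : ∀ j, S * X' j = X j * S) :
    S * f n X' = f m X * S := by
  let P : (Matrix (Fin (m + n)) (Fin (m + n)) k)ˣ :=
    { val := Matrix.reindex finSumFinEquiv finSumFinEquiv (Matrix.fromBlocks 1 S 0 1)
      inv := Matrix.reindex finSumFinEquiv finSumFinEquiv (Matrix.fromBlocks 1 (-S) 0 1)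
      val_inv := by
        simp [Matrix.submatrix_mul_equiv, Matrix.fromBlocks_multiply]
      inv_val := by
        simp [Matrix.submatrix_mul_equiv, Matrix.fromBlocks_multiply] }
  have hD := hΩ m n X X' hX hX'
  have hc : ∀ j, P.val * directSum (X j) (X' j) * P.inv = directSum (X j) (X' j) := by
    intro j
    have := (fromBlocks_comm (A := X j) (B := X' j) (S := S)).mpr ⟨rfl, hS j, rfl⟩
    rw [show P.val * directSum (X j) (X' j) = directSum (X j) (X' j) * P.val from this, mul_assoc,
      P.val_inv, mul_one]
  have hs := hf.map_similar (m + n) (fun j => directSum (X j) (X' j)) P hD (by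
    simp only [hc]; exact hD)
  simp only [hc] at hs
  rw [hf.map_directSum m n X X' hX hX'] at hs
  have h2 : P.val * directSum (f m X) (f n X') = directSum (f m X) (f n X') * P.val := by
    conv_rhs => rw [hs]
    rw [mul_assoc, P.inv_val, mul_one]
  exact (fromBlocks_comm.mp h2).2.1

/-- For `S` the identity this also shows that a value does not depend on the chosen similar point of
Ω. -/
lemma IsValue.intertwine (hΩ : IsNCSet Ω) (hf : IsNCFunction Ω f)
    {W W' : Type*} [AddCommGroup W] [Module k W] [AddCommGroup W'] [Module k W']
    {X : Fin g → Module.End k W} {M : Module.End k W} {X' : Fin g → Module.End k W'}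
    {M' : Module.End k W'} (h : IsValue Ω f X M) (h' : IsValue Ω f X' M') (S : W →ₗ[k] W')
    (hS : ∀ j w, S (X j w) = X' j (S w)) (w : W) : S (M w) = M' (S w) := by
  obtain ⟨n, X₀, e, hX₀, he, hM⟩ := h
  obtain ⟨n', X₀', e', hX₀', he', hM'⟩ := h'
  let T : (Fin n → k) →ₗ[k] (Fin n' → k) := e'.toLinearMap ∘ₗ S ∘ₗ e.symm.toLinearMap
  have hT : ∀ w, T (e w) = e' (S w) := fun w => by simp [T]
  have hTm : ∀ v, (LinearMap.toMatrix' T).mulVec v = T v := fun v => LinearMap.toMatrix'_mulVec T v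
  have := hf.intertwine hΩ hX₀' hX₀ (LinearMap.toMatrix' T) (fun j => by
    refine Matrix.toLin'.injective (LinearMap.ext fun v => ?_)
    obtain ⟨w, rfl⟩ := e.surjective v
    simp only [Matrix.toLin'_apply, ← Matrix.mulVec_mulVec]
    rw [hTm, hTm, ← he, hT, hT, ← he', hS])
  apply e'.injective
  rw [← hT, hM, hM', ← hT, ← hTm, ← hTm, Matrix.mulVec_mulVec, Matrix.mulVec_mulVec, this]

/-- Admissibility yields a point of Ω only with corner αZ; scaling the first summand by α makes it
similar to the extension by Z. -/
lemma IsValue.extOp (hΩ : IsRightAdmissible Ω)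
    {W W' : Type*} [AddCommGroup W] [Module k W] [AddCommGroup W'] [Module k W']
    {X : Fin g → Module.End k W} {M : Module.End k W} {X' : Fin g → Module.End k W'}
    {M' : Module.End k W'} (h : IsValue Ω f X M) (h' : IsValue Ω f X' M')
    (Z : Fin g → W' →ₗ[k] W) : ∃ N, IsValue Ω f (extOp X Z X') N := by
  obtain ⟨m, X₀, e, hX₀, he, -⟩ := h
  obtain ⟨n, X₀', e', hX₀', he', -⟩ := h'
  let Z₀ : Fin g → Matrix (Fin m) (Fin n) k := fun j =>
    LinearMap.toMatrix' (e.toLinearMap ∘ₗ Z j ∘ₗ e'.symm.toLinearMap)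
  obtain ⟨α, hα, hmem⟩ := hΩ m n X₀ X₀' Z₀ hX₀ hX₀'
  let E : (W × W') ≃ₗ[k] (Fin (m + n) → k) :=
    ((e.trans (LinearEquiv.smulOfNeZero k (Fin m → k) α hα)).prodCongr e').trans
      ((LinearEquiv.sumArrowLequivProdArrow (Fin m) (Fin n) k k).symm.trans
        (LinearEquiv.funCongrLeft k k finSumFinEquiv.symm))
  have hE : ∀ w, E w = Sum.elim (α • e w.1) (e' w.2) ∘ finSumFinEquiv.symm := by
    intro w
    funext i
    obtain ⟨i, rfl⟩ := finSumFinEquiv.surjective i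
    cases i <;> simp [E, LinearEquiv.funCongrLeft_apply, LinearMap.funLeft_apply]
  refine ⟨E.symm.toLinearMap ∘ₗ (f (m + n) (upperBlock X₀ (α • Z₀) X₀')).mulVecLin ∘ₗ E.toLinearMap,
    m + n, _, E, hmem, fun j w => ?_, fun w => by simp⟩
  have hZ : (Z₀ j).mulVec (e' w.2) = e (Z j w.2) := by
    simp [Z₀, LinearMap.toMatrix'_mulVec]
  rw [hE, hE, extOp_apply, upperBlock, Matrix.reindex_apply, Matrix.submatrix_mulVec_equiv,
    Function.comp_assoc, Equiv.symm_symm, Equiv.symm_comp_self, Function.comp_id,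
    Matrix.fromBlocks_mulVec]
  congr 1
  rw [Sum.elim_comp_inl, Sum.elim_comp_inr]
  congr 1
  · rw [map_add, smul_add, he, ← hZ, Matrix.mulVec_smul, Pi.smul_apply, Matrix.smul_mulVec]
  · rw [he', Matrix.zero_mulVec, zero_add]

variable (Ω f)

/-- Every invariant subspace is the kernel of an intertwiner into a tuple at which the extended
nc function `f` has a value. -/
def IsResolvable {W : Type u} [AddCommGroup W] [Module k W] (X : Fin g → Module.End k W) : Prop :=
  ∀ U : Submodule k W, (∀ j, ∀ w ∈ U, X j w ∈ U) →
    ∃ (W₁ : Type u) (_ : AddCommGroup W₁) (_ : Module k W₁) (X₁ : Fin g → Module.End k W₁)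
      (M₁ : Module.End k W₁) (S : W →ₗ[k] W₁), IsValue Ω f X₁ M₁ ∧
      (∀ j w, S (X j w) = X₁ j (S w)) ∧ LinearMap.ker S = U

variable {Ω f}

/-- An intertwiner with kernel Aw kills w, and hence also M w, since it carries M to the value at
its target. -/
lemma IsResolvable.value_mem (hΩ : IsNCSet Ω) (hf : IsNCFunction Ω f) {W : Type u}
    [AddCommGroup W] [Module k W] {X : Fin g → Module.End k W} {M : Module.End k W}
    (hX : IsResolvable Ω f X) (hM : IsValue Ω f X M) (w : W) :
    ∃ p, act X p w = M w := by
  let U : Submodule k W :=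
    { carrier := {v | ∃ p, act X p w = v}
      zero_mem' := ⟨0, by simp [act]⟩
      add_mem' := by
        rintro _ _ ⟨p, rfl⟩ ⟨q, rfl⟩
        exact ⟨p + q, by simp⟩
      smul_mem' := by
        rintro c _ ⟨p, rfl⟩
        exact ⟨c • p, by simp⟩ }
  obtain ⟨W₁, _, _, X₁, M₁, S, hM₁, hS, hker⟩ := hX U (by
    rintro j _ ⟨p, rfl⟩
    exact ⟨FreeAlgebra.ι k j * p, by simp⟩)
  have hw : w ∈ LinearMap.ker S := by
    rw [hker]
    exact ⟨1, by simp⟩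
  have : M w ∈ LinearMap.ker S := by
    rw [LinearMap.mem_ker] at hw ⊢
    rw [hM.intertwine hΩ hf hM₁ S hS, hw, map_zero]
  rwa [hker] at this

lemma IsResolvable.congr {W W' : Type u} [AddCommGroup W] [Module k W] [AddCommGroup W']
    [Module k W'] {X : Fin g → Module.End k W} {X' : Fin g → Module.End k W'}
    (h : IsResolvable Ω f X) (e : W' ≃ₗ[k] W) (he : ∀ j w, e (X' j w) = X j (e w)) :
    IsResolvable Ω f X' := by
  intro U hU
  obtain ⟨W₁, i1, i2, X₁, M₁, S, hM₁, hS, hker⟩ := h (U.map e.toLinearMap) (by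
    rintro j _ ⟨w, hw, rfl⟩
    exact ⟨X' j w, hU j w hw, he j w⟩)
  refine ⟨W₁, i1, i2, X₁, M₁, S ∘ₗ e.toLinearMap, hM₁, fun j w => ?_, ?_⟩
  · simp [he, hS]
  · rw [LinearMap.ker_comp, hker]
    exact Submodule.comap_map_eq_of_injective e.injective U

/-- Resolve U ∩ W by S₁ and the image of U in W' by S₂, then look for an intertwiner (S₁, T; 0, S₂)
into an extension of the two targets. -/
lemma IsResolvable.extOp (hΩ : IsRightAdmissible Ω) {W W' : Type u} [AddCommGroup W] [Module k W]
    [AddCommGroup W'] [Module k W'] {X : Fin g → Module.End k W} {X' : Fin g → Module.End k W'}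
    (h : IsResolvable Ω f X) (h' : IsResolvable Ω f X') (Z : Fin g → W' →ₗ[k] W) :
    IsResolvable Ω f (extOp X Z X') := by
  intro U hU
  obtain ⟨W₁, _, _, X₁, M₁, S₁, hM₁, hS₁, hker₁⟩ := h (U.comap (LinearMap.inl k W W'))
    (fun j w hw => by simpa using hU j _ hw)
  obtain ⟨W₂, _, _, X₂, M₂, S₂, hM₂, hS₂, hker₂⟩ := h' (U.map (LinearMap.snd k W W'))
    (by
      rintro j _ ⟨w, hw, rfl⟩
      exact ⟨_, hU j w hw, rfl⟩)
  have hS₁U : ∀ w, S₁ w = 0 ↔ (w, (0 : W')) ∈ U := by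
    intro w
    rw [← LinearMap.mem_ker, hker₁]
    rfl
  have hS₂U : ∀ w', S₂ w' = 0 ↔ ∃ w, (w, w') ∈ U := by
    intro w'
    rw [← LinearMap.mem_ker, hker₂]
    simp
  -- T must send w' to -S₁ w for (w, w') in U; this is well defined because S₁ kills U ∩ W.
  obtain ⟨T₀, hT₀⟩ := exists_linearMap_comp_eq (LinearMap.snd k W W' ∘ₗ U.subtype)
    (-(S₁ ∘ₗ LinearMap.fst k W W' ∘ₗ U.subtype)) (by
      rintro ⟨⟨w, w'⟩, hw⟩ h0
      have h0' : w' = 0 := h0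
      subst h0'
      have := (hS₁U w).mpr hw
      simp [this])
  obtain ⟨T, hT⟩ := LinearMap.exists_extend T₀
  have hTU : ∀ w ∈ U, S₁ w.1 + T w.2 = 0 := by
    intro w hw
    have h1 := LinearMap.congr_fun hT
      ((LinearMap.snd k W W' ∘ₗ U.subtype).rangeRestrict ⟨w, hw⟩)
    rw [hT₀] at h1
    have h2 : T w.2 = -S₁ w.1 := h1
    rw [h2, add_neg_cancel]
  -- The corner of the target is forced on the range of S₂ by the intertwining relation; invariance
  -- of U makes it well defined.
  have hZ : ∀ j, ∃ Z₁ : W₂ →ₗ[k] W₁, ∀ w',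
      Z₁ (S₂ w') = S₁ (Z j w') + T (X' j w') - X₁ j (T w') := by
    intro j
    obtain ⟨ψ, hψ⟩ := exists_linearMap_comp_eq S₂
      (S₁ ∘ₗ Z j + T ∘ₗ X' j - X₁ j ∘ₗ T) (by
        intro w' hw'
        obtain ⟨w, hw⟩ := (hS₂U w').mp hw'
        have h1 := hTU _ hw
        have h2 := hTU _ (hU j _ hw)
        simp only [extOp_apply, map_add, hS₁] at h1 h2
        simp only [LinearMap.mem_ker, LinearMap.sub_apply, LinearMap.add_apply,
          LinearMap.comp_apply]
        rw [eq_neg_of_add_eq_zero_right h1, map_neg, sub_neg_eq_add, ← h2]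
        abel)
    obtain ⟨Z₁, hZ₁⟩ := LinearMap.exists_extend ψ
    exact ⟨Z₁, fun w' => (LinearMap.congr_fun hZ₁ (S₂.rangeRestrict w')).trans (hψ w')⟩
  choose Z₁ hZ₁ using hZ
  obtain ⟨N, hN⟩ := hM₁.extOp hΩ hM₂ Z₁
  obtain ⟨S, hS⟩ : ∃ S : W × W' →ₗ[k] W₁ × W₂, ∀ w, S w = (S₁ w.1 + T w.2, S₂ w.2) :=
    ⟨(S₁ ∘ₗ LinearMap.fst k W W' + T ∘ₗ LinearMap.snd k W W').prod
      (S₂ ∘ₗ LinearMap.snd k W W'), fun _ => rfl⟩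
  refine ⟨W₁ × W₂, inferInstance, inferInstance, _, N, S, hN, fun j w => ?_, ?_⟩
  · simp only [hS, extOp_apply, map_add, hZ₁, hS₁, hS₂, Prod.mk.injEq, and_true]
    abel
  · ext ⟨w, w'⟩
    simp only [LinearMap.mem_ker, hS, Prod.mk_eq_zero]
    constructor
    · rintro ⟨h1, h2⟩
      obtain ⟨u, hu⟩ := (hS₂U w').mp h2
      have h3 := hTU _ hu
      have h4 : (w - u, (0 : W')) ∈ U := by
        rw [← hS₁U, map_sub, sub_eq_zero]
        exact add_right_cancel (h1.trans h3.symm)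
      simpa using U.add_mem h4 hu
    · intro hw
      exact ⟨hTU _ hw, (hS₂U w').mpr ⟨w, hw⟩⟩

end Extensions

end FreeNC
namespace FreeNC

/-! ### Interpolation of nc functions -/

section Interpolation

open NCMod

universe u

variable {k : Type u} [Field k] {g : ℕ} {Ω : ∀ n : ℕ, Set (Point k g n)}
  {f : ∀ n : ℕ, Point k g n → Matrix (Fin n) (Fin n) k}

/-- The target can be `Y` itself: subtract from the identity a module projection onto U. -/
lemma IsSemisimplePoint.isResolvable {s : ℕ} {Y : Point k g s} (hY : IsSemisimplePoint Y)
    (hΩ : Y ∈ Ω s) : IsResolvable Ω f (pointOp Y) := by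
  intro U hU
  have := hY.isSemisimpleModule
  obtain ⟨π, hπ⟩ := exists_projection (submoduleOf (X := pointOp Y) U hU)
  let φ : PtMod Y →ₗ[FreeAlgebra k (Fin g)] PtMod Y :=
    LinearMap.id - (submoduleOf (X := pointOp Y) U hU).subtype ∘ₗ π
  refine ⟨Fin s → k, inferInstance, inferInstance, pointOp Y, (f s Y).mulVecLin, toLin φ,
    isValue_pointOp hΩ, toLin_intertwine φ, ?_⟩
  ext w
  have hφ : toLin φ w = 0 ↔ toMod (pointOp Y) w = (π (toMod (pointOp Y) w)).1 := sub_eq_zero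
  rw [LinearMap.mem_ker, hφ]
  constructor
  · intro h
    rw [← mem_submoduleOf U hU, h]
    exact (π _).2
  · intro h
    exact (congrArg Subtype.val (hπ ⟨toMod (pointOp Y) w, (mem_submoduleOf U hU w).mpr h⟩)).symm

/-- Peeling off the first block exhibits the chain as an extension of `Y` and a shorter chain. -/
lemma isResolvable_chainOp (hΩ : IsRightAdmissible Ω) {s : ℕ} {Y : Point k g s}
    (hY : IsResolvable Ω f (pointOp Y)) (ℓ : ℕ) (Z : Fin ℓ → Point k g s) :
    IsResolvable Ω f (chainOp Y Z) := by
  induction ℓ with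
  | zero =>
    refine hY.congr (LinearEquiv.funUnique (Fin 1) k (Fin s → k)) fun j w => ?_
    exact chainOp_last Y Z j w
  | succ ℓ ih =>
    refine (hY.extOp hΩ (ih (Fin.tail Z)) fun j => (Z 0 j).mulVecLin ∘ₗ LinearMap.proj 0).congr
      (Fin.consLinearEquiv k fun _ => Fin s → k).symm fun j w => ?_
    obtain ⟨⟨v, w⟩, rfl⟩ := (Fin.consLinearEquiv k fun _ : Fin (ℓ + 1 + 1) => Fin s → k).surjective w
    rw [LinearEquiv.symm_apply_eq, LinearEquiv.symm_apply_apply]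
    exact chainOp_cons Y Z j v w

lemma isResolvable_bidiag (hΩ : IsRightAdmissible Ω) {s : ℕ} {Y : Point k g s}
    (hY : IsResolvable Ω f (pointOp Y)) {ℓ : ℕ} (Z : Fin ℓ → Point k g s) :
    IsResolvable Ω f (pointOp (bidiag Y Z)) :=
  (isResolvable_chainOp hΩ hY ℓ Z).congr (blocks k s ℓ) (blocks_bidiag Y Z)

/-- The density trick: apply `IsResolvable.value_mem` to the vector of all `v c` in the direct sum,
formed as an extension with zero corner, and project to the summands. -/
lemma exists_evalPoly_mulVec_eq (hΩ : IsNCSet Ω) (hadm : IsRightAdmissible Ω)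
    (hf : IsNCFunction Ω f) {ι : Type*} {n : ι → ℕ} {X : ∀ c, Point k g (n c)}
    (hX : ∀ c, X c ∈ Ω (n c)) (hres : ∀ c, IsResolvable Ω f (pointOp (X c)))
    (v : ∀ c, Fin (n c) → k) (t : Finset ι) :
    ∃ p, ∀ c ∈ t, (evalPoly p (n c) (X c)).mulVec (v c) = (f (n c) (X c)).mulVec (v c) := by
  -- The empty sum is excluded because Ω need not contain a point of size zero.
  rcases t.eq_empty_or_nonempty with rfl | ht
  · exact ⟨0, by simp⟩
  obtain ⟨W, _, _, XW, M, w, hval, hW, hw⟩ : ∃ (W : Type u) (_ : AddCommGroup W) (_ : Module k W)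
      (XW : Fin g → Module.End k W) (M : Module.End k W) (w : W), IsValue Ω f XW M ∧
      IsResolvable Ω f XW ∧ ∀ c ∈ t, ∃ S : W →ₗ[k] (Fin (n c) → k),
        (∀ j w, S (XW j w) = pointOp (X c) j (S w)) ∧ S w = v c := by
    induction ht using Finset.Nonempty.cons_induction with
    | singleton c =>
      refine ⟨_, inferInstance, inferInstance, _, _, v c, isValue_pointOp (hX c), hres c, ?_⟩
      intro c' hc'
      obtain rfl := Finset.mem_singleton.mp hc'
      exact ⟨LinearMap.id, fun _ _ => rfl, rfl⟩
    | cons c t _ _ ih =>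
      obtain ⟨W, _, _, XW, M, w, hval, hW, hw⟩ := ih
      obtain ⟨N, hN⟩ := (isValue_pointOp (hX c)).extOp hadm hval fun _ => 0
      refine ⟨_, inferInstance, inferInstance, _, N, (v c, w), hN,
        (hres c).extOp hadm hW fun _ => 0, fun c' hc' => ?_⟩
      rcases Finset.mem_cons.mp hc' with rfl | hc'
      · exact ⟨LinearMap.fst k _ _, fun j w => by simp, rfl⟩
      · obtain ⟨S, hS, hSw⟩ := hw c' hc'
        exact ⟨S ∘ₗ LinearMap.snd k _ _, fun j w => by simpa using hS j w.2, hSw⟩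
  obtain ⟨p, hp⟩ := hW.value_mem hΩ hf hval w
  refine ⟨p, fun c hc => ?_⟩
  obtain ⟨S, hS, hSw⟩ := hw c hc
  rw [evalPoly_mulVec, ← hSw, ← act_intertwine S hS, hp,
    hval.intertwine hΩ hf (isValue_pointOp (hX c)) S hS]
  rfl

/-- Finitely many functionals span all the others. Solve for these, and compare with a solution for
one further condition: both agree on the span, so the further condition holds as well. -/
lemma exists_forall_dual_eq {A D ι : Type*} [AddCommGroup A] [Module k A] [AddCommGroup D]
    [Module k D] [Module.Finite k D] (Φ : A →ₗ[k] D) (φ : ι → Module.Dual k D) (b : ι → k)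
    (h : ∀ t : Finset ι, ∃ p, ∀ c ∈ t, φ c (Φ p) = b c) : ∃ p, ∀ c, φ c (Φ p) = b c := by
  classical
  obtain ⟨t, ht, hspan⟩ := (Submodule.fg_span_iff_fg_span_finset_subset (R := k)
    (Set.range φ)).mp (IsNoetherian.noetherian _)
  choose r hr using fun x : (t : Set (Module.Dual k D)) => ht x.2
  obtain ⟨p, hp⟩ := h (Finset.univ.image r)
  refine ⟨p, fun c => ?_⟩
  obtain ⟨q, hq⟩ := h (insert c (Finset.univ.image r))
  rw [← hq c (Finset.mem_insert_self _ _)]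
  have hc : φ c ∈ Submodule.span k (t : Set (Module.Dual k D)) :=
    hspan ▸ Submodule.subset_span ⟨c, rfl⟩
  generalize φ c = ψ at hc ⊢
  induction hc using Submodule.span_induction with
  | mem x hx =>
    have hx' := Finset.mem_image_of_mem r (Finset.mem_univ ⟨x, hx⟩)
    rw [← show φ (r ⟨x, hx⟩) = x from hr ⟨x, hx⟩, hp _ hx', hq _ (Finset.mem_insert_of_mem hx')]
  | zero => simp
  | add x y _ _ hx hy => simp [hx, hy]
  | smul a x _ hx => simp [hx]

/-- The differentials of polynomials as a linear map. -/
noncomputable def polyDiffₗ {s : ℕ} (Y : Point k g s) (ℓ : ℕ) :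
    FreeAlgebra k (Fin g) →ₗ[k] MultiMap k g s ℓ where
  toFun p := polyDiff Y p ℓ
  map_add' p q := by simp [polyDiff]
  map_smul' c p := by simp [polyDiff]

/-- The existence of the differential of `f` as a multilinear map comes along: it is the
differential of the interpolating polynomial. -/
theorem exists_polyDiff_isNCDifferential (hΩ : IsNCSet Ω) (hadm : IsRightAdmissible Ω)
    (hf : IsNCFunction Ω f) {h : ℕ} {s : Fin h → ℕ} {Y : ∀ i, Point k g (s i)}
    (hY : ∀ i, Y i ∈ Ω (s i)) (hss : ∀ i, IsSemisimplePoint (Y i)) (L : ℕ) :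
    ∃ p, ∀ i, ∀ ℓ ≤ L, IsNCDifferential Ω f (Y i) (polyDiff (Y i) p ℓ) := by
  -- One scalar condition for each bidiagonal point in Ω and each entry of its upper right block.
  let ι := Σ (i : Fin h) (ℓ : Fin (L + 1)),
    {Z : Fin ℓ.val → Point k g (s i) // bidiag (Y i) Z ∈ Ω _} × Fin (s i) × Fin (s i)
  let D := ∀ (i : Fin h) (ℓ : Fin (L + 1)), MultiMap k g (s i) ℓ.val
  let Φ : FreeAlgebra k (Fin g) →ₗ[k] D :=
    LinearMap.pi fun i => LinearMap.pi fun ℓ => polyDiffₗ (Y i) ℓ.val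
  let φ : ι → Module.Dual k D := fun c =>
    { toFun := fun T => T c.1 c.2.1 c.2.2.1.1 c.2.2.2.1 c.2.2.2.2
      map_add' := fun T T' => rfl
      map_smul' := fun a T => rfl }
  obtain ⟨p, hp⟩ := exists_forall_dual_eq Φ φ
    (fun c => topRight (f _ (bidiag (Y c.1) c.2.2.1.1)) c.2.2.2.1 c.2.2.2.2) (fun t => by
      obtain ⟨p, hp⟩ := exists_evalPoly_mulVec_eq hΩ hadm hf
        (X := fun c : ι => bidiag (Y c.1) c.2.2.1.1) (fun c => c.2.2.1.2)
        (fun c => isResolvable_bidiag hadm ((hss c.1).isResolvable (hY c.1)) _)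
        (fun c => (blocks k _ _).symm (Pi.single (Fin.last _) (Pi.single c.2.2.2.2 1))) t
      refine ⟨p, fun c hc => ?_⟩
      change polyDiff (Y c.1) p _ c.2.2.1.1 c.2.2.2.1 c.2.2.2.2 = _
      rw [← topRight_evalPoly_bidiag, topRight_apply, topRight_apply, hp c hc])
  refine ⟨p, fun i ℓ hℓ Z hZ => ?_⟩
  ext a b
  exact (hp ⟨i, ⟨ℓ, Nat.lt_succ_of_le hℓ⟩, ⟨Z, hZ⟩, a, b⟩).symm

end Interpolation

end FreeNC

theorem theoremD {k : Type*} [Field k] [CharZero k] (g : ℕ) :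
    (∀ (h : ℕ) (s : Fin h → ℕ) (Y : ∀ i, FreeNC.Point k g (s i)),
      (∀ i, FreeNC.IsSemisimplePoint (Y i)) → FreeNC.Separated Y →
      ∀ (L : ℕ) (F : ∀ (i : Fin h) (ℓ : ℕ), FreeNC.MultiMap k g (s i) ℓ),
        (∀ i, FreeNC.TruncLAC (Y i) L (F i)) →
        ∃ p : FreeAlgebra k (Fin g), ∀ (i : Fin h) (ℓ : ℕ), ℓ ≤ L →
          FreeNC.IsNCDifferential (fun _ => Set.univ) (FreeNC.evalPoly p) (Y i) (F i ℓ)) ∧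
    (∀ (Ω : ∀ n : ℕ, Set (FreeNC.Point k g n))
      (f : ∀ n : ℕ, FreeNC.Point k g n → Matrix (Fin n) (Fin n) k),
      FreeNC.IsNCSet Ω → FreeNC.IsRightAdmissible Ω → FreeNC.IsNCFunction Ω f →
      ∀ (h : ℕ) (s : Fin h → ℕ) (Y : ∀ i, FreeNC.Point k g (s i)),
        (∀ i, Y i ∈ Ω (s i)) → (∀ i, FreeNC.IsSemisimplePoint (Y i)) →
        ∀ L : ℕ, ∃ p : FreeAlgebra k (Fin g), ∀ (i : Fin h) (ℓ : ℕ), ℓ ≤ L →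
          ∃ T : FreeNC.MultiMap k g (s i) ℓ,
            FreeNC.IsNCDifferential Ω f (Y i) T ∧
            FreeNC.IsNCDifferential (fun _ => Set.univ) (FreeNC.evalPoly p) (Y i) T) := by
  refine ⟨fun h s Y hY hsep L F hF => ?_, fun Ω f hΩ hadm hf h s Y hYΩ hY L => ?_⟩
  · obtain ⟨p, hp⟩ := FreeNC.exists_polyDiff_eq_of_separated hY hsep L F hF
    exact ⟨p, fun i ℓ hℓ => hp i ℓ hℓ ▸ FreeNC.isNCDifferential_evalPoly (Y i) p ℓ⟩
  · obtain ⟨p, hp⟩ := FreeNC.exists_polyDiff_isNCDifferential hΩ hadm hf hYΩ hY L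
    exact ⟨p, fun i ℓ hℓ => ⟨_, hp i ℓ hℓ, FreeNC.isNCDifferential_evalPoly (Y i) p ℓ⟩⟩
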